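/- For an integer $n\ge 1$ and a real $\lambda$ let $p_{n,\lambda}=n^{-1}+\lambda n^{-4/3}$, assumed to lie in $[0,1]$ (for $n\ge 2$ this is automatic when $|\lambda|\le n^{1/12}$). Consider the Erdős–Rényi random graph on $n$ labelled vertices in which each edge is present independently with probability $p_{n,\lambda}$, and write $\mathbb E_{n,\lambda}$ for the corresponding expectation. For integers $k\ge 1$ and $l$, let $X(k,k+l)$ be the number of connected components of this graph with exactly $k$ vertices and exactly $k+l$ edges, and let $C(k,k+l)$ be the number of connected graphs on $k$ labelled vertices with exactly $k+l$ edges. Put $$F_\lambda(x)=\frac{x^3}{6}-\frac{\lambda x^2}{2}+\frac{\lambda^2x}{2},\qquad \mathrm{err}(k,n,l,\lambda)=\frac{k^4}{n^3}+\frac{|\lambda l|}{n^{1/3}}+\frac{k|\lambda|^3}{n}+\frac kn+\frac1k .$$ (a) Suppose that $|\lambda|\le n^{1/12}$, $1\le k\le n^{3/4}$ and $l\le 4n^{1/4}$. Then $$\mathbb E_{n,\lambda}[X(k,k+l)]=\frac{C(k,k+l)}{(2\pi)^{1/2}\,n^l\,k^{k+1/2}}\,e^{-F_\lambda(k/n^{2/3})}\bigl(1+O(\mathrm{err}(k,n,l,\lambda))\bigr),$$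 where the constant implicit in $O(\cdot)$ is absolute (it does not depend on $n$, $k$, $l$ or $\lambda$). (b) There is a finite absolute constant $c$ such that for all $n\ge 3$, $|\lambda|\le n^{1/12}$, $1\le k\le n-1$ and $l\ge -1$, $$\mathbb E_{n,\lambda}[X(k,k+l)]\le \frac ck\left(\frac{k^3}{n^2(l\vee 1)}\right)^{l/2}e^{-F_\lambda(k/n^{2/3})+\frac13\lambda^3kn^{-1}}\left(\frac{1+\lambda n^{-1/3}}{1-2n^{-1}}\right)^l ,$$ where $l\vee 1=\max(l,1)$. -/

import Mathlib

open MeasureTheory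

namespace NearCriticalGraph

/-- The edge probability `p = n⁻¹ + lam * n^(-4/3)` of the near-critical random graph. -/
noncomputable def edgeProb (n : ℕ) (lam : ℝ) : ℝ :=
  (n : ℝ)⁻¹ + lam * (n : ℝ) ^ (-(4 / 3) : ℝ)

/-- The number of connected components of `G` with exactly `k` vertices and exactly `m` edges.
The number of edges is an integer parameter, so that it may be written as `k + l` with `l = -1`. -/
noncomputable def componentCount {V : Type*} (G : SimpleGraph V) (k : ℕ) (m : ℤ) : ℕ :=
  {c : G.ConnectedComponent |
    c.supp.ncard = k ∧ (c.toSimpleGraph.edgeSet.ncard : ℤ) = m}.ncard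

/-- `C(k, m)`: the number of connected graphs on `k` labelled vertices with exactly `m` edges. -/
noncomputable def connectedCount (k : ℕ) (m : ℤ) : ℕ :=
  {G : SimpleGraph (Fin k) | G.Connected ∧ (G.edgeSet.ncard : ℤ) = m}.ncard

/-- The expected number of components with `k` vertices and `m` edges in the Erdős–Rényi graph
on `n` labelled vertices, each edge being present independently with probability `p`. -/
noncomputable def expectedCount (n : ℕ) (p : unitInterval) (k : ℕ) (m : ℤ) : ℝ :=
  ∫ G, (componentCount G k m : ℝ) ∂(SimpleGraph.binomialRandom (Fin n) p)

/-- `F_lam(x) = x³/6 - lam x²/2 + lam² x/2`. -/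
noncomputable def F (lam x : ℝ) : ℝ :=
  x ^ 3 / 6 - lam * x ^ 2 / 2 + lam ^ 2 * x / 2

/-- The relative error term
`k⁴/n³ + |lam l|/n^(1/3) + k |lam|³/n + k/n + 1/k`. -/
noncomputable def relErr (k n : ℕ) (l : ℤ) (lam : ℝ) : ℝ :=
  (k : ℝ) ^ 4 / (n : ℝ) ^ 3 + |lam * l| / (n : ℝ) ^ (1 / 3 : ℝ) + k * |lam| ^ 3 / n
    + (k : ℝ) / n + 1 / (k : ℝ)

/-- The main term `C(k, k + l) / ((2π)^(1/2) n^l k^(k + 1/2)) * exp (-F_lam(k / n^(2/3)))`. -/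
noncomputable def mainTerm (k n : ℕ) (l : ℤ) (lam : ℝ) : ℝ :=
  (connectedCount k (k + l) : ℝ)
      / ((2 * Real.pi) ^ (1 / 2 : ℝ) * (n : ℝ) ^ l * (k : ℝ) ^ ((k : ℝ) + 1 / 2))
    * Real.exp (-F lam (k / (n : ℝ) ^ (2 / 3 : ℝ)))

/-- The upper bound, without its constant factor. -/
noncomputable def upperTerm (k n : ℕ) (l : ℤ) (lam : ℝ) : ℝ :=
  1 / (k : ℝ) * ((k : ℝ) ^ 3 / ((n : ℝ) ^ 2 * max (l : ℝ) 1)) ^ ((l : ℝ) / 2)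
    * Real.exp (-F lam (k / (n : ℝ) ^ (2 / 3 : ℝ)) + 1 / 3 * lam ^ 3 * k * (n : ℝ)⁻¹)
    * ((1 + lam * (n : ℝ) ^ (-(1 / 3) : ℝ)) / (1 - 2 * (n : ℝ)⁻¹)) ^ l

end NearCriticalGraph

/-!
Splitting a graph along the vertex set `S` of a component gives the exact first moment
`E[X(k, m)] = (n choose k) C(k, m) p ^ m (1 - p) ^ (k (k - 1) / 2 + k (n - k) - m)`
(`expectedCount_eq`), so both parts are estimates of this product. Write `p = (1 + e) / n` with
`e = λ n ^ (-1/3)`, the `deviation`; then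
`F_λ(k / n ^ (2/3)) = k³ / (6 n²) - e k² / (2 n) + e² k / 2`.

For (a), expand the logarithm of the ratio of the two sides: `log (1 - j / n)` to second order in
the falling factorial, Stirling's formula for `k!`, `log (1 + e)` to second order, and
`log (1 - p)` to first order. Everything cancels up to a multiple of the error term
(`abs_log_momentRatio_le`), and the error term is bounded by `8` (`relErr_le`), so the estimate may
be exponentiated.

For (b), one-sided versions of these expansions hold without restriction on `k`
(`choose_mul_pow_le`); the cubic term of `log (1 + e)` is the correction `λ³ k / (3 n)`. What
remains is the uniform bound `C(k, k + l) ≤ c k ^ (k - 1/2 + 3 l / 2) l ^ (-l / 2)` on the number of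
connected graphs (`connectedCount_le`), and `C(k, k - 1) ≤ k ^ (k - 2)` for trees.

* For `84 l ≤ k`, delete a marked edge of a connected graph: either the graph stays connected or it
  falls into two connected graphs (`two_mul_mul_connectedCount_le`). For the generating functions
  `V r` of vertex-rooted connected graphs of cyclomatic number `r` this reads
  `2 V (r + 1) ≤ x (d/dx) V r + ∑ V i V j` over `i + j = r + 1`, coefficientwise. Since `V 0` is at
  most the tree function `T`, the terms with `i = 0` or `j = 0` can be moved to the left, and induction
  dominates `V (l + 1)` by a multiple of `(1 - T) ^ (-(3 l + 2))`, as in Wright's work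
  (`excessSeries_succ_le`). The identity `(1 - T)⁻¹ = ∑ k ^ k x ^ k / k!`, a form of Abel's
  identity, and the equation `x (d/dx) U = U³ - U²` for `U = (1 - T)⁻¹` give a recursion for the
  coefficients of these powers (`mapCoeff_le`).
* For `84 l > k`, the bound comes from probability. The components with `k` vertices of `G(n, p)`
  are disjoint, so `k E[X(k, m)] ≤ n` for every `n` and `p`. Summing these inequalities over `n`
  against a geometric series bounds `C(k, m) p ^ m (1 - p) ^ (k (k - 1) / 2 - m)`, and
  `1 - p = exp (-L / k)` with `L = √(12 l / k)` yields the claimed bound with an additional factor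
  of order `k² (e / 12) ^ (l / 2)`, where now `e = exp 1`; it is bounded since `e < 12` and
  `k < 84 l`.
-/

namespace NearCriticalGraph

/-! ### Graphs split along a set of vertices -/

section Join

open SimpleGraph

/-- No edge of `G` leaves the vertex set `S`. -/
def IsSeparated {V : Type*} (G : SimpleGraph V) (S : Set V) : Prop :=
  ∀ u ∈ S, ∀ v ∉ S, ¬ G.Adj u v

/-- The disjoint union of a graph on `S` and a graph on `Sᶜ`, as a graph on the whole type. -/
def joinGraph {V : Type*} (S : Set V) (H : SimpleGraph S) (H' : SimpleGraph ↥Sᶜ) :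
    SimpleGraph V :=
  H.spanningCoe ⊔ H'.spanningCoe

/-- The connected graphs on the vertex type `α` with `m` edges. -/
def connGraphs (α : Type*) (m : ℕ) : Set (SimpleGraph α) :=
  {G | G.Connected ∧ G.edgeSet.ncard = m}

variable {V : Type*} {S : Set V}

lemma joinGraph_adj (H : SimpleGraph S) (H' : SimpleGraph ↥Sᶜ) (u v : V) :
    (joinGraph S H H').Adj u v ↔
      (∃ (hu : u ∈ S) (hv : v ∈ S), H.Adj ⟨u, hu⟩ ⟨v, hv⟩) ∨
      (∃ (hu : u ∈ Sᶜ) (hv : v ∈ Sᶜ), H'.Adj ⟨u, hu⟩ ⟨v, hv⟩) := by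
  simp only [joinGraph, sup_adj, map_adj, Function.Embedding.subtype_apply]
  constructor
  · rintro (⟨a, b, h, rfl, rfl⟩ | ⟨a, b, h, rfl, rfl⟩)
    · exact .inl ⟨a.2, b.2, h⟩
    · exact .inr ⟨a.2, b.2, h⟩
  · rintro (⟨hu, hv, h⟩ | ⟨hu, hv, h⟩)
    · exact .inl ⟨_, _, h, rfl, rfl⟩
    · exact .inr ⟨_, _, h, rfl, rfl⟩

lemma isSeparated_joinGraph (H : SimpleGraph S) (H' : SimpleGraph ↥Sᶜ) :
    IsSeparated (joinGraph S H H') S := by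
  intro u hu v hv h
  rw [joinGraph_adj] at h
  rcases h with ⟨_, h, _⟩ | ⟨h, _, _⟩
  · exact hv h
  · exact h hu

lemma induce_joinGraph_left (H : SimpleGraph S) (H' : SimpleGraph ↥Sᶜ) :
    (joinGraph S H H').induce S = H := by
  ext u v
  rw [comap_adj, joinGraph_adj]
  constructor
  · rintro (⟨_, _, h⟩ | ⟨h, _, _⟩)
    · exact h
    · exact absurd u.2 h
  · intro h
    exact .inl ⟨u.2, v.2, h⟩

lemma induce_joinGraph_right (H : SimpleGraph S) (H' : SimpleGraph ↥Sᶜ) :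
    (joinGraph S H H').induce Sᶜ = H' := by
  ext u v
  rw [comap_adj, joinGraph_adj]
  constructor
  · rintro (⟨h, _, _⟩ | ⟨_, _, h⟩)
    · exact absurd h u.2
    · exact h
  · intro h
    exact .inr ⟨u.2, v.2, h⟩

lemma joinGraph_induce {G : SimpleGraph V} (hG : IsSeparated G S) :
    joinGraph S (G.induce S) (G.induce Sᶜ) = G := by
  ext u v
  rw [joinGraph_adj]
  simp only [comap_adj, Function.Embedding.subtype_apply]
  constructor
  · rintro (⟨_, _, h⟩ | ⟨_, _, h⟩) <;> exact h
  · intro h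
    by_cases hu : u ∈ S <;> by_cases hv : v ∈ S
    · exact .inl ⟨hu, hv, h⟩
    · exact absurd h (hG u hu v hv)
    · exact absurd h.symm (hG v hv u hu)
    · exact .inr ⟨hu, hv, h⟩

lemma ncard_edgeSet_spanningCoe (H : SimpleGraph S) :
    H.spanningCoe.edgeSet.ncard = H.edgeSet.ncard := by
  rw [edgeSet_map]
  exact Set.ncard_image_of_injective _ (Function.Embedding.injective _)

lemma ncard_edgeSet_joinGraph [Finite V] (H : SimpleGraph S) (H' : SimpleGraph ↥Sᶜ) :
    (joinGraph S H H').edgeSet.ncard = H.edgeSet.ncard + H'.edgeSet.ncard := by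
  rw [joinGraph, edgeSet_sup, Set.ncard_union_eq ?_ (Set.toFinite _) (Set.toFinite _),
    ncard_edgeSet_spanningCoe, ncard_edgeSet_spanningCoe]
  rw [disjoint_edgeSet, disjoint_left]
  intro u v h h'
  simp only [map_adj, Function.Embedding.subtype_apply] at h h'
  obtain ⟨a, b, -, rfl, -⟩ := h
  obtain ⟨c, d, -, h, -⟩ := h'
  exact c.2 (h ▸ a.2)

end Join

/-! ### Relabelling the vertices -/

section Transport

open SimpleGraph

lemma ncard_edgeSet_of_iso {V W : Type*} {G : SimpleGraph V} {G' : SimpleGraph W}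
    (e : G ≃g G') : G.edgeSet.ncard = G'.edgeSet.ncard := by
  rw [← Nat.card_coe_set_eq, ← Nat.card_coe_set_eq]
  exact Nat.card_congr e.mapEdgeSet

lemma connectedCount_natCast (k m : ℕ) :
    connectedCount k m = (connGraphs (Fin k) m).ncard := by
  simp [connectedCount, connGraphs]

lemma ncard_connGraphs_congr {α β : Type*} (e : α ≃ β) (m : ℕ) :
    (connGraphs α m).ncard = (connGraphs β m).ncard := by
  rw [← Set.ncard_image_of_injective (connGraphs β m) (Equiv.simpleGraph e.symm).injective]
  congr 1
  have key : ∀ G : SimpleGraph β, (Equiv.simpleGraph e.symm) G ∈ connGraphs α m ↔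
      G ∈ connGraphs β m := by
    intro G
    have i : (Equiv.simpleGraph e.symm) G ≃g G := SimpleGraph.Iso.comap e G
    simp only [connGraphs, Set.mem_ofPred_eq, i.connected_iff, ncard_edgeSet_of_iso i]
  ext G
  constructor
  · intro hG
    refine ⟨(Equiv.simpleGraph e.symm).symm G, (key _).1 ?_, ?_⟩ <;> simp [hG]
  · rintro ⟨G', hG', rfl⟩
    exact (key G').2 hG'

lemma ncard_connGraphs {α : Type*} [Finite α] (m : ℕ) :
    (connGraphs α m).ncard = connectedCount (Nat.card α) m := by
  rw [connectedCount_natCast]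
  exact ncard_connGraphs_congr (Finite.equivFin α) m

end Transport

/-! ### Components as separated connected sets -/

section Components

open SimpleGraph

variable {V : Type*}

lemma isSeparated_supp {G : SimpleGraph V} (c : G.ConnectedComponent) : IsSeparated G c.supp := by
  intro u hu v hv h
  exact hv ((c.mem_supp_congr_adj h).1 hu)

lemma IsSeparated.mem_of_reachable {G : SimpleGraph V} {S : Set V} (hS : IsSeparated G S)
    {u v : V} (h : G.Reachable u v) (hu : u ∈ S) : v ∈ S := by
  obtain ⟨w⟩ := h
  induction w with
  | nil => exact hu
  | cons h _ ih =>
    by_contra hv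
    exact hS _ hu _ (fun hh => hv (ih hh)) h

/-- The supports of the connected components are the sets which no edge leaves and which induce a
connected subgraph. -/
lemma exists_supp_eq_iff {G : SimpleGraph V} {S : Set V} :
    (∃ c : G.ConnectedComponent, c.supp = S) ↔ IsSeparated G S ∧ (G.induce S).Connected := by
  constructor
  · rintro ⟨c, rfl⟩
    exact ⟨isSeparated_supp c, c.connected_toSimpleGraph⟩
  · rintro ⟨hS, hc⟩
    obtain ⟨⟨v, hv⟩⟩ := hc.nonempty
    refine ⟨G.connectedComponentMk v, ?_⟩
    ext w
    rw [ConnectedComponent.mem_supp_iff, ConnectedComponent.eq]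
    constructor
    · intro h
      exact hS.mem_of_reachable h.symm hv
    · intro hw
      exact ((hc.preconnected ⟨w, hw⟩ ⟨v, hv⟩).map (Embedding.induce S).toHom)

lemma componentCount_eq (G : SimpleGraph V) (k m : ℕ) :
    componentCount G k m = {S : Set V | S.ncard = k ∧ IsSeparated G S ∧
      G.induce S ∈ connGraphs S m}.ncard := by
  rw [componentCount, ← Set.ncard_image_of_injective _ ConnectedComponent.supp_injective]
  congr 1
  ext S
  simp only [Set.mem_image, Set.mem_ofPred_eq, connGraphs]
  constructor
  · rintro ⟨c, ⟨h1, h2⟩, rfl⟩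
    exact ⟨h1, isSeparated_supp c, c.connected_toSimpleGraph, by exact_mod_cast h2⟩
  · rintro ⟨h1, h2, h3, h4⟩
    obtain ⟨c, rfl⟩ := exists_supp_eq_iff.2 ⟨h2, h3⟩
    exact ⟨c, ⟨h1, by exact_mod_cast h4⟩, rfl⟩

end Components

/-! ### The exact first moment -/

section Expectation

open SimpleGraph

lemma ncard_edgeSet_le_choose {V : Type*} [Finite V] (G : SimpleGraph V) :
    G.edgeSet.ncard ≤ (Nat.card V).choose 2 := by
  classical
  have := Fintype.ofFinite V
  rw [Nat.card_eq_fintype_card, Set.ncard_eq_toFinset_card', ← edgeFinset]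
  exact card_edgeFinset_le_card_choose_two

lemma binomialRandom_real_singleton {V : Type*} [Finite V] (p : unitInterval)
    (G : SimpleGraph V) :
    (binomialRandom V p).real {G} =
      (p : ℝ) ^ G.edgeSet.ncard * (1 - p : ℝ) ^ ((Nat.card V).choose 2 - G.edgeSet.ncard) := by
  simp [measureReal_def, binomialRandom_singleton]

instance {V : Type*} [Countable V] : MeasurableSingletonClass (SimpleGraph V) :=
  ⟨fun G => by
    have h := measurable_edgeSet (V := V) (measurableSet_singleton G.edgeSet)
    have h' : edgeSet ⁻¹' {G.edgeSet} = {G} := by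
      ext G'
      simp
    rwa [h'] at h⟩

lemma integral_binomialRandom {V : Type*} [Fintype V] [Fintype (SimpleGraph V)]
    (p : unitInterval) (f : SimpleGraph V → ℝ) :
    ∫ G, f G ∂(binomialRandom V p) = ∑ G, (p : ℝ) ^ G.edgeSet.ncard *
      (1 - p : ℝ) ^ ((Nat.card V).choose 2 - G.edgeSet.ncard) * f G := by
  rw [integral_fintype (Integrable.of_finite)]
  simp [binomialRandom_real_singleton]

lemma sum_binomialRandom_weights (V : Type*) [Fintype V] [Fintype (SimpleGraph V)]
    (p : unitInterval) :
    ∑ G : SimpleGraph V, (p : ℝ) ^ G.edgeSet.ncard *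
      (1 - p : ℝ) ^ ((Nat.card V).choose 2 - G.edgeSet.ncard) = 1 := by
  have := integral_binomialRandom (V := V) p (fun _ => 1)
  simpa using this.symm

lemma choose_two_add (a b : ℕ) : (a + b).choose 2 = a.choose 2 + b.choose 2 + a * b := by
  induction b with
  | zero => simp
  | succ b ih =>
    rw [← add_assoc, Nat.choose_succ_succ' (a + b) 1, ih, Nat.choose_succ_succ' b 1]
    simp
    ring

/-- The probability that `S` is the vertex set of a connected component with `m` edges. -/
lemma sum_weights_component {V : Type*} [Fintype V] [Fintype (SimpleGraph V)]
    (p : unitInterval) (S : Set V) (m : ℕ) [DecidablePred fun G : SimpleGraph V =>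
      IsSeparated G S ∧ G.induce S ∈ connGraphs S m] :
    ∑ G : SimpleGraph V with IsSeparated G S ∧ G.induce S ∈ connGraphs S m,
      (p : ℝ) ^ G.edgeSet.ncard * (1 - p : ℝ) ^ ((Nat.card V).choose 2 - G.edgeSet.ncard) =
    connectedCount S.ncard m * (p : ℝ) ^ m *
      (1 - p : ℝ) ^ (S.ncard.choose 2 + S.ncard * (Nat.card V - S.ncard) - m) := by
  classical
  have : Fintype (SimpleGraph S) := Fintype.ofFinite _
  have : Fintype (SimpleGraph ↥Sᶜ) := Fintype.ofFinite _
  have hS : Nat.card S = S.ncard := Nat.card_coe_set_eq S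
  have hSc : Nat.card ↥Sᶜ = Nat.card V - S.ncard := by
    rw [Nat.card_coe_set_eq, Set.ncard_compl]
  have hle : S.ncard ≤ Nat.card V := Set.ncard_le_card S
  have hN : (Nat.card V).choose 2 = S.ncard.choose 2 + (Nat.card V - S.ncard).choose 2 +
      S.ncard * (Nat.card V - S.ncard) := by
    rw [← choose_two_add, Nat.add_sub_cancel' hle]
  calc _ = ∑ H : SimpleGraph S × SimpleGraph ↥Sᶜ with H.1 ∈ connGraphs S m,
        (p : ℝ) ^ (H.1.edgeSet.ncard + H.2.edgeSet.ncard) *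
        (1 - p : ℝ) ^ ((Nat.card V).choose 2 - (H.1.edgeSet.ncard + H.2.edgeSet.ncard)) := by
        refine Finset.sum_bij' (fun G _ => (G.induce S, G.induce Sᶜ))
          (fun H _ => joinGraph S H.1 H.2) ?_ ?_ ?_ ?_ ?_
        · intro G hG
          simp only [Finset.mem_filter, Finset.mem_univ, true_and] at hG ⊢
          exact hG.2
        · intro H hH
          simp only [Finset.mem_filter, Finset.mem_univ, true_and] at hH ⊢
          exact ⟨isSeparated_joinGraph _ _, by rwa [induce_joinGraph_left]⟩
        · intro G hG
          simp only [Finset.mem_filter, Finset.mem_univ, true_and] at hG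
          exact joinGraph_induce hG.1
        · intro H hH
          exact Prod.ext (induce_joinGraph_left _ _) (induce_joinGraph_right _ _)
        · intro G hG
          simp only [Finset.mem_filter, Finset.mem_univ, true_and] at hG
          rw [← ncard_edgeSet_joinGraph, joinGraph_induce hG.1]
    _ = ∑ H : SimpleGraph S with H ∈ connGraphs S m, ∑ H' : SimpleGraph ↥Sᶜ,
        (p : ℝ) ^ (H.edgeSet.ncard + H'.edgeSet.ncard) *
        (1 - p : ℝ) ^ ((Nat.card V).choose 2 - (H.edgeSet.ncard + H'.edgeSet.ncard)) := by
        rw [← Finset.sum_product' (f := fun (H : SimpleGraph S) (H' : SimpleGraph ↥Sᶜ) =>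
          (p : ℝ) ^ (H.edgeSet.ncard + H'.edgeSet.ncard) *
          (1 - p : ℝ) ^ ((Nat.card V).choose 2 - (H.edgeSet.ncard + H'.edgeSet.ncard)))]
        refine Finset.sum_congr ?_ fun _ _ => rfl
        ext H
        simp
    _ = ∑ H : SimpleGraph S with H ∈ connGraphs S m, (p : ℝ) ^ m *
      (1 - p : ℝ) ^ (S.ncard.choose 2 + S.ncard * (Nat.card V - S.ncard) - m) := by
        refine Finset.sum_congr rfl fun H hH => ?_
        have hm : H.edgeSet.ncard = m := by
          simpa using (Finset.mem_filter.1 hH).2.2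
        have h1 := ncard_edgeSet_le_choose H
        rw [hS, hm] at h1
        have h2 := sum_binomialRandom_weights ↥Sᶜ p
        rw [hm]
        refine Eq.trans ?_ (mul_one _)
        refine Eq.trans ?_ (congrArg _ h2)
        rw [Finset.mul_sum]
        refine Finset.sum_congr rfl fun H' _ => ?_
        have h3 := ncard_edgeSet_le_choose H'
        rw [hSc] at h3 ⊢
        have h4 : (Nat.card V).choose 2 - (m + H'.edgeSet.ncard) =
            (S.ncard.choose 2 + S.ncard * (Nat.card V - S.ncard) - m) +
            ((Nat.card V - S.ncard).choose 2 - H'.edgeSet.ncard) := by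
          omega
        rw [h4, pow_add, pow_add]
        ring
    _ = _ := by
        rw [Finset.sum_const, nsmul_eq_mul, ← mul_assoc]
        congr 3
        rw [← hS, ← ncard_connGraphs, ← Set.ncard_coe_finset]
        congr
        ext H
        simp

/-- The exact first moment of the number of components with `k` vertices and `m` edges. -/
lemma expectedCount_eq (n : ℕ) (p : unitInterval) (k m : ℕ) :
    expectedCount n p k m = n.choose k * connectedCount k m * (p : ℝ) ^ m *
      (1 - p : ℝ) ^ (k.choose 2 + k * (n - k) - m) := by
  classical
  have : Fintype (SimpleGraph (Fin n)) := Fintype.ofFinite _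
  rw [expectedCount, integral_binomialRandom]
  have h1 : ∀ G : SimpleGraph (Fin n), (componentCount G k m : ℝ) =
      ∑ S : Set (Fin n) with S.ncard = k,
        if IsSeparated G S ∧ G.induce S ∈ connGraphs S m then (1 : ℝ) else 0 := by
    intro G
    rw [componentCount_eq, Finset.sum_boole, ← Set.ncard_coe_finset]
    congr
    ext S
    simp [and_comm]
  simp_rw [h1, Finset.mul_sum]
  rw [Finset.sum_comm]
  have h2 : ∀ S ∈ (Finset.univ.filter fun S : Set (Fin n) => S.ncard = k),
      (∑ G : SimpleGraph (Fin n), (p : ℝ) ^ G.edgeSet.ncard *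
        (1 - p : ℝ) ^ ((Nat.card (Fin n)).choose 2 - G.edgeSet.ncard) *
        if IsSeparated G S ∧ G.induce S ∈ connGraphs S m then (1 : ℝ) else 0) =
      connectedCount k m * (p : ℝ) ^ m * (1 - p : ℝ) ^ (k.choose 2 + k * (n - k) - m) := by
    intro S hS
    have hS : S.ncard = k := (Finset.mem_filter.1 hS).2
    have := sum_weights_component p S m
    rw [hS, Nat.card_fin] at this
    rw [← this, Finset.sum_filter]
    refine Finset.sum_congr rfl fun G _ => ?_
    split_ifs <;> simp
  rw [Finset.sum_congr rfl h2, Finset.sum_const, nsmul_eq_mul]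
  have h3 : (Finset.univ.filter fun S : Set (Fin n) => S.ncard = k).card = n.choose k := by
    rw [← Set.ncard_coe_finset]
    have := Set.ncard_powerset_ncard (Set.toFinite (Set.univ : Set (Fin n))) k
    simpa [Set.ncard_univ] using this
  rw [h3]
  ring

/-- The components with `k` vertices are disjoint sets of vertices. -/
lemma mul_componentCount_le {n : ℕ} (G : SimpleGraph (Fin n)) (k : ℕ) (m : ℤ) :
    k * componentCount G k m ≤ n := by
  classical
  have : Fintype G.ConnectedComponent := Fintype.ofFinite _
  rw [componentCount, Set.ncard_eq_toFinset_card']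
  set s := ({c : G.ConnectedComponent |
    c.supp.ncard = k ∧ (c.toSimpleGraph.edgeSet.ncard : ℤ) = m}).toFinset
  calc k * s.card = ∑ c ∈ s, (Finset.univ.filter fun v => G.connectedComponentMk v = c).card := by
        rw [mul_comm, ← smul_eq_mul, ← Finset.sum_const]
        refine Finset.sum_congr rfl fun c hc => ?_
        have hc : c.supp.ncard = k := by
          have := (Set.mem_toFinset.1 hc)
          exact this.1
        rw [← hc, ← Set.ncard_coe_finset]
        congr 1
        ext v
        simp [ConnectedComponent.mem_supp_iff]
    _ ≤ ∑ c : G.ConnectedComponent,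
          (Finset.univ.filter fun v => G.connectedComponentMk v = c).card :=
        Finset.sum_le_sum_of_subset (Finset.subset_univ s)
    _ = n := by
        have := Finset.card_eq_sum_card_fiberwise (s := (Finset.univ : Finset (Fin n)))
          (t := Finset.univ) (f := G.connectedComponentMk) (fun v _ => by simp)
        rw [← this, Finset.card_fin]

lemma mul_expectedCount_le (n : ℕ) (p : unitInterval) (k : ℕ) (m : ℤ) :
    k * expectedCount n p k m ≤ n := by
  classical
  have : Fintype (SimpleGraph (Fin n)) := Fintype.ofFinite _
  have h := sum_binomialRandom_weights (Fin n) p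
  rw [expectedCount, integral_binomialRandom, Finset.mul_sum]
  calc _ ≤ ∑ G : SimpleGraph (Fin n), (p : ℝ) ^ G.edgeSet.ncard *
      (1 - p : ℝ) ^ ((Nat.card (Fin n)).choose 2 - G.edgeSet.ncard) * n := by
        refine Finset.sum_le_sum fun G _ => ?_
        rw [mul_left_comm]
        have hp0 := p.2.1
        have hp1 : 0 ≤ 1 - (p : ℝ) := sub_nonneg.2 p.2.2
        refine mul_le_mul_of_nonneg_left ?_ (by positivity)
        exact_mod_cast mul_componentCount_le G k m
    _ = n := by rw [← Finset.sum_mul, h, one_mul]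

end Expectation

/-! ### Deleting an edge of a connected graph -/

section EdgeDeletion

open SimpleGraph

variable {V : Type*}

lemma ncard_adj_pairs [Finite V] (G : SimpleGraph V) :
    {q : V × V | G.Adj q.1 q.2}.ncard = 2 * G.edgeSet.ncard := by
  classical
  have := Fintype.ofFinite V
  have h1 : {q : V × V | G.Adj q.1 q.2} = Set.range (fun d : G.Dart => d.toProd) := by
    ext q
    constructor
    · intro h
      exact ⟨⟨q, h⟩, rfl⟩
    · rintro ⟨d, rfl⟩
      exact d.adj
  rw [h1, ← Set.image_univ, Set.ncard_image_of_injective _ Dart.toProd_injective, Set.ncard_univ,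
    Nat.card_eq_fintype_card, dart_card_eq_twice_card_edges, Set.ncard_eq_toFinset_card',
    ← edgeFinset]

/-- The triples `(G, u, v)` of a connected graph with `m` edges and an oriented edge of it. -/
def markedGraphs (V : Type*) (m : ℕ) : Set (SimpleGraph V × V × V) :=
  {t | t.1 ∈ connGraphs V m ∧ t.1.Adj t.2.1 t.2.2}

lemma ncard_markedGraphs (V : Type*) [Finite V] (m : ℕ) :
    (markedGraphs V m).ncard = 2 * m * (connGraphs V m).ncard := by
  classical
  have : Fintype (SimpleGraph V) := Fintype.ofFinite _
  have := Fintype.ofFinite V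
  have h1 : (markedGraphs V m).toFinset = ((connGraphs V m).toFinset.sigma
      (fun G => {q : V × V | G.Adj q.1 q.2}.toFinset)).map
      (Equiv.sigmaEquivProd (SimpleGraph V) (V × V)).toEmbedding := by
    ext ⟨G, q⟩
    rw [Set.mem_toFinset]
    simp [markedGraphs]
  rw [Set.ncard_eq_toFinset_card', h1, Finset.card_map, Finset.card_sigma,
    Finset.sum_congr rfl (g := fun _ => 2 * m), Finset.sum_const, smul_eq_mul, mul_comm,
    ← Set.ncard_eq_toFinset_card']
  intro G hG
  rw [← Set.ncard_eq_toFinset_card', ncard_adj_pairs, (Set.mem_toFinset.1 hG).2]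

/-- Deleting a marked edge whose removal keeps the graph connected leaves a connected graph with an
ordered pair of distinct vertices, from which the graph can be recovered. -/
lemma ncard_marked_nonbridge_le [Finite V] (m : ℕ) :
    {t ∈ markedGraphs V (m + 1) | (t.1.deleteEdges {s(t.2.1, t.2.2)}).Connected}.ncard ≤
      Nat.card V * (Nat.card V - 1) * (connGraphs V m).ncard := by
  classical
  have := Fintype.ofFinite V
  have h1 : (Set.offDiag (Set.univ : Set V)).ncard = Nat.card V * (Nat.card V - 1) := by
    have : Set.offDiag (Set.univ : Set V) = ((Finset.univ : Finset V).offDiag : Set (V × V)) := by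
      ext; simp
    rw [this, Set.ncard_coe_finset, Finset.offDiag_card, Finset.card_univ,
      Nat.card_eq_fintype_card, Nat.mul_sub_one]
  rw [← h1, mul_comm, ← Set.ncard_prod]
  refine Set.ncard_le_ncard_of_injOn
    (fun t => (t.1.deleteEdges {s(t.2.1, t.2.2)}, t.2)) ?_ ?_ (Set.toFinite _)
  · rintro ⟨G, u, v⟩ ⟨⟨⟨hG, hm⟩, huv⟩, hc⟩
    refine ⟨⟨hc, ?_⟩, by simpa [Set.mem_offDiag] using huv.ne⟩
    have huv : s(u, v) ∈ G.edgeSet := huv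
    simp only [edgeSet_deleteEdges] at hm ⊢
    rw [Set.ncard_sdiff_singleton_of_mem huv, hm]
    rfl
  · rintro ⟨G, u, v⟩ ⟨⟨⟨hG, hm⟩, huv⟩, hc⟩ ⟨G', u', v'⟩ ⟨⟨⟨hG', hm'⟩, huv'⟩, hc'⟩ h
    simp only [Prod.mk.injEq] at h
    obtain ⟨h, rfl, rfl⟩ := h
    refine Prod.ext ?_ rfl
    have e : G.edgeSet \ {s(u, v)} = G'.edgeSet \ {s(u, v)} := by
      rw [← edgeSet_deleteEdges, ← edgeSet_deleteEdges, h]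
    have huv : s(u, v) ∈ G.edgeSet := huv
    have huv' : s(u, v) ∈ G'.edgeSet := huv'
    rw [← edgeSet_inj, ← Set.insert_sdiff_self_of_mem huv, e, Set.insert_sdiff_self_of_mem huv']

/-- The marked graphs `(G, u, v)` for which deleting the edge `uv` leaves exactly the two
components `S ∋ u` and `Sᶜ ∋ v`, with `i` and `j` edges. -/
def bridgeGraphs (S : Set V) (i j : ℕ) : Set (SimpleGraph V × V × V) :=
  {t | t.1.Adj t.2.1 t.2.2 ∧ t.2.1 ∈ S ∧ t.2.2 ∈ Sᶜ ∧
    IsSeparated (t.1.deleteEdges {s(t.2.1, t.2.2)}) S ∧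
    (t.1.deleteEdges {s(t.2.1, t.2.2)}).induce S ∈ connGraphs S i ∧
    (t.1.deleteEdges {s(t.2.1, t.2.2)}).induce Sᶜ ∈ connGraphs ↥Sᶜ j}

lemma ncard_bridgeGraphs_le [Finite V] (S : Set V) (i j : ℕ) :
    (bridgeGraphs S i j).ncard ≤ S.ncard * (Nat.card V - S.ncard) *
      (connectedCount S.ncard i * connectedCount (Nat.card V - S.ncard) j) := by
  classical
  rw [← Set.ncard_compl, ← Set.ncard_prod, ← Nat.card_coe_set_eq S, ← Nat.card_coe_set_eq Sᶜ,
    ← ncard_connGraphs, ← ncard_connGraphs, ← Set.ncard_prod, ← Set.ncard_prod]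
  refine Set.ncard_le_ncard_of_injOn (fun t => (t.2,
    (t.1.deleteEdges {s(t.2.1, t.2.2)}).induce S,
    (t.1.deleteEdges {s(t.2.1, t.2.2)}).induce Sᶜ)) ?_ ?_ (Set.toFinite _)
  · rintro ⟨G, u, v⟩ ⟨h1, h2, h3, h4, h5, h6⟩
    exact ⟨⟨h2, h3⟩, h5, h6⟩
  · rintro ⟨G, u, v⟩ ⟨huv, h2, h3, h4, h5, h6⟩ ⟨G', u', v'⟩ ⟨huv', h2', h3', h4', h5', h6'⟩ h
    simp only [Prod.mk.injEq] at h
    obtain ⟨⟨rfl, rfl⟩, ha, hb⟩ := h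
    refine Prod.ext ?_ rfl
    have h := joinGraph_induce h4
    simp only [ha, hb] at h
    rw [joinGraph_induce h4'] at h
    have e : G.edgeSet \ {s(u, v)} = G'.edgeSet \ {s(u, v)} := by
      rw [← edgeSet_deleteEdges, ← edgeSet_deleteEdges, h]
    have huv : s(u, v) ∈ G.edgeSet := huv
    have huv' : s(u, v) ∈ G'.edgeSet := huv'
    rw [← edgeSet_inj, ← Set.insert_sdiff_self_of_mem huv, e, Set.insert_sdiff_self_of_mem huv']

lemma reachable_deleteEdges_or {G : SimpleGraph V} {u v w : V} (h : G.Reachable u w) :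
    (G.deleteEdges {s(u, v)}).Reachable u w ∨ (G.deleteEdges {s(u, v)}).Reachable v w := by
  rw [reachable_iff_reflTransGen] at h
  induction h with
  | refl => exact .inl .rfl
  | @tail x y _ hxy ih =>
    by_cases he : s(x, y) = s(u, v)
    · rw [Sym2.eq_iff] at he
      rcases he with ⟨-, rfl⟩ | ⟨-, rfl⟩
      · exact .inr .rfl
      · exact .inl .rfl
    · have hxy' : (G.deleteEdges {s(u, v)}).Adj x y := by
        rw [deleteEdges_adj]
        exact ⟨hxy, he⟩
      exact ih.imp (fun h => h.trans hxy'.reachable) (fun h => h.trans hxy'.reachable)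

lemma exists_bridgeGraphs [Finite V] {m : ℕ} {t : SimpleGraph V × V × V}
    (ht : t ∈ markedGraphs V (m + 1))
    (hc : ¬ (t.1.deleteEdges {s(t.2.1, t.2.2)}).Connected) :
    ∃ S : Set V, ∃ ij ∈ Finset.HasAntidiagonal.antidiagonal m, t ∈ bridgeGraphs S ij.1 ij.2 := by
  obtain ⟨G, u, v⟩ := t
  obtain ⟨⟨hG, hm⟩, huv⟩ := ht
  simp only at hG hm huv hc
  set G' := G.deleteEdges {s(u, v)} with hG'
  have hnr : ¬ G'.Reachable u v := by
    intro h
    have : Nonempty V := ⟨u⟩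
    apply hc
    rw [connected_iff_exists_forall_reachable]
    refine ⟨u, fun w => ?_⟩
    rcases reachable_deleteEdges_or (v := v) (hG.preconnected u w) with h' | h'
    · exact h'
    · exact h.trans h'
  set S : Set V := (G'.connectedComponentMk u).supp with hS
  have hmS : ∀ w, w ∈ S ↔ G'.Reachable w u := by
    intro w
    rw [hS, ConnectedComponent.mem_supp_iff, ConnectedComponent.eq]
  have hSc : Sᶜ = (G'.connectedComponentMk v).supp := by
    ext w
    rw [Set.mem_compl_iff, hmS, ConnectedComponent.mem_supp_iff, ConnectedComponent.eq]
    constructor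
    · intro h
      rcases reachable_deleteEdges_or (v := v) (hG.preconnected u w) with h' | h'
      · exact absurd h'.symm h
      · exact h'.symm
    · intro h h'
      exact hnr (h'.symm.trans h)
  have hsep : IsSeparated G' S := isSeparated_supp _
  have hedge : (G'.induce S).edgeSet.ncard + (G'.induce Sᶜ).edgeSet.ncard = m := by
    rw [← ncard_edgeSet_joinGraph, joinGraph_induce hsep, hG', edgeSet_deleteEdges]
    have huv : s(u, v) ∈ G.edgeSet := huv
    rw [Set.ncard_sdiff_singleton_of_mem huv, hm]
    rfl
  refine ⟨S, ((G'.induce S).edgeSet.ncard, (G'.induce Sᶜ).edgeSet.ncard),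
    Finset.HasAntidiagonal.mem_antidiagonal.2 hedge, huv, (hmS u).2 .rfl, ?_, hsep,
    ⟨(exists_supp_eq_iff.1 ⟨_, rfl⟩).2, rfl⟩, ⟨?_, rfl⟩⟩
  · exact fun h => hnr ((hmS v).1 h).symm
  · exact (exists_supp_eq_iff.1 ⟨_, hSc.symm⟩).2

/-- Marking an oriented edge of a connected graph and deleting it leaves either a connected graph
with a marked pair of vertices, or two connected graphs on complementary vertex sets. -/
lemma two_mul_mul_connectedCount_le (k m : ℕ) :
    2 * (m + 1) * connectedCount k ((m + 1 : ℕ) : ℤ) ≤ k * (k - 1) * connectedCount k m +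
      ∑ s ∈ Finset.range (k + 1), k.choose s * (s * (k - s) *
        ∑ ij ∈ Finset.HasAntidiagonal.antidiagonal m,
          connectedCount s ij.1 * connectedCount (k - s) ij.2) := by
  classical
  have e : ∀ j : ℕ, connectedCount k j = (connGraphs (Fin k) j).ncard := connectedCount_natCast k
  rw [e, e, ← ncard_markedGraphs]
  have hsub : markedGraphs (Fin k) (m + 1) ⊆
      {t ∈ markedGraphs (Fin k) (m + 1) | (t.1.deleteEdges {s(t.2.1, t.2.2)}).Connected} ∪
      ⋃ x ∈ (Finset.univ : Finset (Finset (Fin k))) ×ˢ Finset.HasAntidiagonal.antidiagonal m,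
        bridgeGraphs (x.1 : Set (Fin k)) x.2.1 x.2.2 := by
    intro t ht
    by_cases hc : (t.1.deleteEdges {s(t.2.1, t.2.2)}).Connected
    · exact .inl ⟨ht, hc⟩
    · obtain ⟨S, ij, hij, h⟩ := exists_bridgeGraphs ht hc
      refine .inr (Set.mem_iUnion₂.2 ⟨(S.toFinset, ij), ?_, ?_⟩)
      · exact Finset.mem_product.2 ⟨Finset.mem_univ _, hij⟩
      · simpa using h
  refine (Set.ncard_le_ncard hsub (Set.toFinite _)).trans ((Set.ncard_union_le _ _).trans ?_)
  refine add_le_add ?_ ?_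
  · have := ncard_marked_nonbridge_le (V := Fin k) m
    rwa [Nat.card_fin] at this
  · refine (Finset.set_ncard_biUnion_le _ _).trans ?_
    rw [Finset.sum_product]
    calc _ ≤ ∑ S : Finset (Fin k), (S.card * (k - S.card) *
          ∑ ij ∈ Finset.HasAntidiagonal.antidiagonal m, connectedCount S.card ij.1 *
            connectedCount (k - S.card) ij.2) := by
          refine Finset.sum_le_sum fun S _ => ?_
          rw [Finset.mul_sum]
          refine Finset.sum_le_sum fun ij _ => ?_
          have := ncard_bridgeGraphs_le (S : Set (Fin k)) ij.1 ij.2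
          rwa [Nat.card_fin, Set.ncard_coe_finset] at this
      _ = _ := by
          rw [← Finset.powerset_univ, Finset.sum_powerset_apply_card (fun s => s * (k - s) *
            ∑ ij ∈ Finset.HasAntidiagonal.antidiagonal m,
              connectedCount s ij.1 * connectedCount (k - s) ij.2)]
          simp

end EdgeDeletion

/-! ### Abel's identity and the tree function -/

section TreeFunction

open PowerSeries Finset.Nat
open scoped Nat

/-- Abel's identity, for rooted labelled trees. The number of these is written `s * s ^ (s - 2)`,
which is `s ^ (s - 1)` for `s ≥ 1` and vanishes for `s = 0`. Both sides have the same derivative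
in `y` by induction, and they agree at `y = -n`. -/
lemma abel_identity (n : ℕ) (y : ℝ) :
    ∑ s ∈ Finset.range (n + 1), (n.choose s : ℝ) * (s * (s : ℝ) ^ (s - 2)) *
      (y + (n - s : ℕ)) ^ (n - s) = n * (y + n) ^ (n - 1) := by
  induction n generalizing y with
  | zero => simp
  | succ n ih =>
    set f : ℝ → ℝ := fun y => ∑ s ∈ Finset.range (n + 2), ((n + 1).choose s : ℝ) *
      (s * (s : ℝ) ^ (s - 2)) * (y + (n + 1 - s : ℕ)) ^ (n + 1 - s) -
      (n + 1 : ℕ) * (y + (n + 1 : ℕ)) ^ n with hf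
    have hderiv : ∀ y, HasDerivAt f 0 y := by
      intro y
      have h1 : HasDerivAt f (∑ s ∈ Finset.range (n + 2), ((n + 1).choose s : ℝ) *
          (s * (s : ℝ) ^ (s - 2)) * ((n + 1 - s : ℕ) * (y + (n + 1 - s : ℕ)) ^ (n + 1 - s - 1) * 1)
          - (n + 1 : ℕ) * (n * (y + (n + 1 : ℕ)) ^ (n - 1) * 1)) y := by
        refine HasDerivAt.sub (HasDerivAt.fun_sum fun s _ => ?_) ?_
        · exact (((hasDerivAt_id y).add_const _).pow _).const_mul _
        · exact (((hasDerivAt_id y).add_const _).pow _).const_mul _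
      convert h1 using 1
      rw [Finset.sum_range_succ]
      have h2 := ih (y + 1)
      have h3 : ∑ s ∈ Finset.range (n + 1), ((n + 1).choose s : ℝ) *
          (s * (s : ℝ) ^ (s - 2)) * ((n + 1 - s : ℕ) * (y + (n + 1 - s : ℕ)) ^ (n + 1 - s - 1) * 1)
          = (n + 1) * ∑ s ∈ Finset.range (n + 1), (n.choose s : ℝ) * (s * (s : ℝ) ^ (s - 2)) *
      (y + 1 + (n - s : ℕ)) ^ (n - s) := by
        rw [Finset.mul_sum]
        refine Finset.sum_congr rfl fun s hs => ?_
        have hs : s ≤ n := by simpa [Nat.lt_succ_iff] using hs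
        have e1 := Nat.choose_mul_succ_eq n s
        have e2 : ((n.choose s : ℝ)) * (n + 1) = (n + 1).choose s * (n + 1 - s : ℕ) := by
          exact_mod_cast e1
        have e3 : n + 1 - s = n - s + 1 := by omega
        rw [e3] at e2 ⊢
        simp only [Nat.add_sub_cancel]
        push_cast at e2 ⊢
        have e4 : y + ((n - s : ℕ) + 1 : ℝ) = y + 1 + (n - s : ℕ) := by ring
        rw [e4]
        linear_combination (-(s * (s : ℝ) ^ (s - 2)) * (y + 1 + (n - s : ℕ)) ^ (n - s)) * e2
      rw [h3, h2]
      push_cast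
      simp only [Nat.sub_self, Nat.cast_zero]
      rw [show y + (n + 1 : ℝ) = y + 1 + n by ring]
      ring
    have hconst : ∀ y z, f y = f z :=
      is_const_of_deriv_eq_zero (fun y => (hderiv y).differentiableAt) fun y => (hderiv y).deriv
    -- at `y = -(n + 1)` the left side is an `(n + 1)`-st difference of a power of exponent `n`
    have h0 : f (-(n + 1 : ℕ)) = 0 := by
      rcases Nat.eq_zero_or_pos n with rfl | hn
      · simp [hf, Finset.sum_range_succ]
      · have h4 := congrFun (fwdDiff_iter_pow_eq_zero_of_lt (R := ℝ) (Nat.lt_succ_self n)) 0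
        rw [fwdDiff_iter_eq_sum_shift] at h4
        simp only [Pi.zero_apply] at h4
        simp only [hf]
        rw [neg_add_cancel, zero_pow hn.ne', mul_zero, sub_zero, ← h4]
        refine Finset.sum_congr rfl fun s hs => ?_
        have hs : s ≤ n + 1 := by simpa [Nat.lt_succ_iff] using hs
        have e5 : (-((n + 1 : ℕ) : ℝ) + (n + 1 - s : ℕ)) = -s := by
          rw [Nat.cast_sub hs]; ring
        rw [e5]
        rcases Nat.eq_zero_or_pos s with rfl | hs0
        · simp [hn.ne']
        · have e6 : (s : ℝ) * (s : ℝ) ^ (s - 2) = (s : ℝ) ^ (s - 1) := by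
            rcases Nat.lt_or_ge s 2 with h | h
            · obtain rfl : s = 1 := by omega
              simp
            · rw [← pow_succ']
              congr 1
              omega
          have e7 : (s : ℝ) ^ n = (s : ℝ) ^ (s - 1) * (s : ℝ) ^ (n + 1 - s) := by
            rw [← pow_add]; congr 1; omega
          rw [e6, neg_pow]
          simp only [zero_add, nsmul_eq_mul, mul_one, zsmul_eq_mul]
          push_cast
          rw [e7]
          ring
    have := hconst y (-(n + 1 : ℕ))
    rw [h0] at this
    simp only [hf] at this
    rw [sub_eq_zero] at this
    simpa using this

/-- The exponential generating function of rooted labelled trees,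
`T = ∑ k ^ (k - 1) x ^ k / k!`. -/
noncomputable def treeSeries : ℝ⟦X⟧ := PowerSeries.mk fun k => (k * (k : ℝ) ^ (k - 2)) / k !

/-- The series `U = ∑ k ^ k x ^ k / k!`, which is the inverse of `1 - T`. -/
noncomputable def mapSeries : ℝ⟦X⟧ := PowerSeries.mk fun k => (k : ℝ) ^ k / k !

/-- The operator `x d/dx` on power series. -/
noncomputable def theta (f : ℝ⟦X⟧) : ℝ⟦X⟧ := PowerSeries.mk fun n => n * coeff n f

@[simp] lemma coeff_theta (f : ℝ⟦X⟧) (n : ℕ) : coeff n (theta f) = n * coeff n f := coeff_mk _ _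

lemma theta_mul (f g : ℝ⟦X⟧) : theta (f * g) = theta f * g + f * theta g := by
  ext n
  rw [coeff_theta, map_add, coeff_mul, coeff_mul, coeff_mul, Finset.mul_sum,
    ← Finset.sum_add_distrib]
  refine Finset.sum_congr rfl fun ij hij => ?_
  rw [coeff_theta, coeff_theta, ← Finset.HasAntidiagonal.mem_antidiagonal.1 hij]
  push_cast
  ring

lemma theta_sub (f g : ℝ⟦X⟧) : theta (f - g) = theta f - theta g := by
  ext n
  simp [mul_sub]

lemma theta_one : theta 1 = 0 := by
  ext n
  rw [coeff_theta, coeff_one]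
  split_ifs with h <;> simp [h]

/-- The product of exponential generating functions is a binomial convolution. -/
lemma factorial_mul_coeff_mul (f g : ℕ → ℝ) (n : ℕ) :
    (n ! : ℝ) * coeff n ((PowerSeries.mk fun k => f k / k !) * (PowerSeries.mk fun k => g k / k !))
      = ∑ s ∈ Finset.range (n + 1), (n.choose s : ℝ) * f s * g (n - s) := by
  rw [coeff_mul, Finset.Nat.sum_antidiagonal_eq_sum_range_succ_mk, Finset.mul_sum]
  refine Finset.sum_congr rfl fun s hs => ?_
  have hs : s ≤ n := by simpa [Nat.lt_succ_iff] using hs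
  rw [coeff_mk, coeff_mk, Nat.cast_choose ℝ hs]
  field_simp

lemma treeSeries_mul_mapSeries : treeSeries * mapSeries = mapSeries - 1 := by
  ext n
  have hn : (n ! : ℝ) ≠ 0 := by positivity
  apply mul_left_cancel₀ hn
  rw [treeSeries, mapSeries, factorial_mul_coeff_mul]
  have h := abel_identity n 0
  simp only [zero_add] at h
  rw [h, map_sub, coeff_mk, coeff_one]
  rcases Nat.eq_zero_or_pos n with rfl | h0
  · simp
  · rw [if_neg h0.ne', sub_zero, mul_div_cancel₀ _ hn, ← pow_succ']
    congr 1
    omega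

lemma theta_treeSeries : theta treeSeries = mapSeries - 1 := by
  ext n
  rw [coeff_theta, map_sub, treeSeries, mapSeries, coeff_mk, coeff_mk, coeff_one]
  rcases Nat.lt_or_ge n 2 with h | h
  · interval_cases n <;> simp
  · rw [if_neg (by omega), sub_zero, mul_div_assoc', ← mul_assoc, ← pow_two, ← pow_add]
    congr 2
    omega

lemma mapSeries_mul_one_sub : mapSeries * (1 - treeSeries) = 1 := by
  linear_combination -treeSeries_mul_mapSeries

lemma theta_mapSeries : theta mapSeries = mapSeries ^ 3 - mapSeries ^ 2 := by
  have h := congrArg theta treeSeries_mul_mapSeries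
  rw [theta_mul, theta_sub, theta_one, theta_treeSeries] at h
  have h2 := mapSeries_mul_one_sub
  linear_combination -mapSeries * h - (theta mapSeries) * h2

lemma theta_mapSeries_pow (a : ℕ) :
    theta (mapSeries ^ (a + 1)) =
      ((a + 1 : ℕ) : ℝ⟦X⟧) * (mapSeries ^ (a + 3) - mapSeries ^ (a + 2)) := by
  induction a with
  | zero => simp [theta_mapSeries]
  | succ a ih =>
    rw [pow_succ, theta_mul, ih, theta_mapSeries]
    push_cast
    ring

/-- The coefficient form of Cayley's recursion for rooted trees. -/
lemma coeff_treeSeries_sq (n : ℕ) :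
    n * coeff n (treeSeries ^ 2) = 2 * (n - 1) * coeff n treeSeries := by
  have h : theta (treeSeries ^ 2) = 2 * (theta treeSeries - treeSeries) := by
    rw [pow_two, theta_mul, theta_treeSeries]
    linear_combination 2 * treeSeries_mul_mapSeries
  have h' := congrArg (coeff n) h
  rw [coeff_theta, ← map_ofNat (C (R := ℝ)) 2, coeff_C_mul, map_sub, coeff_theta] at h'
  linear_combination h'

end TreeFunction

/-! ### Coefficientwise domination of power series -/

section Domination

open PowerSeries Finset.Nat
open scoped Nat

/-- Coefficientwise comparison of power series. -/
def Dominated (f g : ℝ⟦X⟧) : Prop := ∀ n, coeff n f ≤ coeff n g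

lemma Dominated.mul {f g f' g' : ℝ⟦X⟧} (hf' : Dominated 0 f') (hg : Dominated 0 g)
    (h1 : Dominated f g) (h2 : Dominated f' g') : Dominated (f * f') (g * g') := fun n => by
  rw [coeff_mul, coeff_mul]
  refine Finset.sum_le_sum fun ij _ => ?_
  have a := hf' ij.2
  have b := hg ij.1
  rw [map_zero] at a b
  exact mul_le_mul (h1 _) (h2 _) a b

lemma Dominated.mul_nonneg {f g : ℝ⟦X⟧} (hf : Dominated 0 f) (hg : Dominated 0 g) :
    Dominated 0 (f * g) := fun n => by
  rw [coeff_mul, map_zero]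
  refine Finset.sum_nonneg fun ij _ => ?_
  have a := hf ij.1
  have b := hg ij.2
  rw [map_zero] at a b
  exact _root_.mul_nonneg a b

lemma Dominated.theta {f g : ℝ⟦X⟧} (h : Dominated f g) :
    Dominated (theta f) (theta g) := fun n => by
  rw [coeff_theta, coeff_theta]
  exact mul_le_mul_of_nonneg_left (h n) (by positivity)

lemma Dominated.smul {f g : ℝ⟦X⟧} (h : Dominated f g) {c : ℝ} (hc : 0 ≤ c) :
    Dominated (c • f) (c • g) := fun n => by
  simpa using mul_le_mul_of_nonneg_left (h n) hc

lemma mapSeries_nonneg : Dominated 0 mapSeries := fun n => by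
  rw [mapSeries, coeff_mk, map_zero]
  positivity

lemma treeSeries_nonneg : Dominated 0 treeSeries := fun n => by
  rw [treeSeries, coeff_mk, map_zero]
  positivity

lemma mapSeries_pow_nonneg (a : ℕ) : Dominated 0 (mapSeries ^ a) := by
  induction a with
  | zero =>
    intro n
    rw [pow_zero, coeff_one, map_zero]
    split_ifs <;> norm_num
  | succ a ih => rw [pow_succ]; exact ih.mul_nonneg mapSeries_nonneg

lemma theta_mapSeries_pow_le (a : ℕ) :
    Dominated (theta (mapSeries ^ (a + 1))) (((a + 1 : ℕ) : ℝ) • mapSeries ^ (a + 3)) := by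
  intro n
  have h := mapSeries_pow_nonneg (a + 2) n
  rw [theta_mapSeries_pow, show ((a + 1 : ℕ) : ℝ⟦X⟧) = C ((a + 1 : ℕ) : ℝ) by simp, coeff_C_mul,
    map_sub, PowerSeries.coeff_smul, smul_eq_mul]
  refine mul_le_mul_of_nonneg_left ?_ (by positivity)
  rw [map_zero] at h
  linarith

/-- An inequality `(1 - T) f ≤ g` may be multiplied by `U = (1 - T)⁻¹`. -/
lemma dominated_mul_mapSeries {f g : ℝ⟦X⟧} (h : Dominated f (g + treeSeries * f)) :
    Dominated f (mapSeries * g) := by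
  intro n
  induction n using Nat.strong_induction_on with
  | _ n ih =>
    have e : mapSeries * g = g + treeSeries * (mapSeries * g) := by
      linear_combination -g * treeSeries_mul_mapSeries
    refine (h n).trans ?_
    rw [e, map_add, map_add]
    refine add_le_add_right ?_ _
    rw [coeff_mul, coeff_mul]
    refine Finset.sum_le_sum fun ij hij => ?_
    have hij := Finset.HasAntidiagonal.mem_antidiagonal.1 hij
    rcases Nat.eq_zero_or_pos ij.1 with h0 | h0
    · have : coeff ij.1 treeSeries = 0 := by rw [h0, treeSeries, coeff_mk]; simp
      rw [this]; simp
    · have a := treeSeries_nonneg ij.1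
      rw [map_zero] at a
      exact mul_le_mul_of_nonneg_left (ih ij.2 (by omega)) a

end Domination

/-! ### Generating functions of connected graphs -/

section Excess

open PowerSeries
open scoped Nat

/-- The number of connected labelled graphs with `k` vertices and `k - 1 + r` edges, that is, of
cyclomatic number `r`; zero for `k = 0`. -/
noncomputable def excessCount (r k : ℕ) : ℕ :=
  if k = 0 then 0 else connectedCount k ((k - 1 + r : ℕ) : ℤ)

/-- The exponential generating function of the vertex-rooted connected graphs of cyclomatic
number `r`. -/
noncomputable def excessSeries (r : ℕ) : ℝ⟦X⟧ :=
  PowerSeries.mk fun k => (k * (excessCount r k : ℝ)) / k !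

lemma excessSeries_nonneg (r : ℕ) : Dominated 0 (excessSeries r) := fun n => by
  rw [excessSeries, coeff_mk, map_zero]
  positivity

lemma connectedCount_eq_zero {k : ℕ} {m : ℤ} (h : m + 1 < k) : connectedCount k m = 0 := by
  rw [connectedCount]
  convert Set.ncard_empty (SimpleGraph (Fin k))
  rw [Set.eq_empty_iff_forall_notMem]
  rintro G ⟨hc, hm⟩
  have := hc.card_vert_le_card_edgeSet_add_one
  rw [Nat.card_fin, Nat.card_coe_set_eq] at this
  omega

lemma connectedCount_one_zero_le : connectedCount 1 ((0 : ℕ) : ℤ) ≤ 1 := by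
  rw [connectedCount_natCast]
  have h : (connGraphs (Fin 1) 0).Subsingleton := fun G _ G' _ => by
    ext u v
    have : u = v := Subsingleton.elim _ _
    simp [this]
  exact (Set.ncard_le_one_iff_subsingleton).2 h

lemma sum_antidiagonal_connectedCount {s t : ℕ} (hs : s ≠ 0) (ht : t ≠ 0) (r : ℕ) :
    ∑ ij ∈ Finset.HasAntidiagonal.antidiagonal (s - 1 + (t - 1) + r),
      connectedCount s ij.1 * connectedCount t ij.2 =
    ∑ hh ∈ Finset.HasAntidiagonal.antidiagonal r, excessCount hh.1 s * excessCount hh.2 t := by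
  symm
  refine Finset.sum_bij_ne_zero (fun hh _ _ => (s - 1 + hh.1, t - 1 + hh.2)) ?_ ?_ ?_ ?_
  · intro hh h _
    rw [Finset.HasAntidiagonal.mem_antidiagonal] at h ⊢
    simp only
    omega
  · intro a _ _ b _ _ h
    simp only [Prod.mk.injEq] at h
    ext <;> omega
  · intro ij hij hne
    rw [Finset.HasAntidiagonal.mem_antidiagonal] at hij
    have h1 : s - 1 ≤ ij.1 := by
      by_contra hlt
      apply hne
      rw [connectedCount_eq_zero (k := s) (by omega), zero_mul]
    have h2 : t - 1 ≤ ij.2 := by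
      by_contra hlt
      apply hne
      rw [connectedCount_eq_zero (k := t) (by omega), mul_zero]
    refine ⟨(ij.1 - (s - 1), ij.2 - (t - 1)), ?_, ?_, ?_⟩
    · rw [Finset.HasAntidiagonal.mem_antidiagonal]
      simp only
      omega
    · simp only [excessCount, if_neg hs, if_neg ht, Nat.add_sub_cancel' h1,
        Nat.add_sub_cancel' h2]
      exact hne
    · ext <;> simp only <;> omega
  · intro hh _ _
    simp only [excessCount, if_neg hs, if_neg ht]

/-- The edge deletion recursion, indexed by the cyclomatic number. -/
lemma two_mul_excessCount_le {k r : ℕ} (hk : k ≠ 0) (hkr : 1 ≤ k - 1 + r) :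
    2 * ((k - 1 + r : ℕ) : ℝ) * excessCount r k ≤
      (k * (k - 1 : ℕ) : ℝ) * connectedCount k ((k - 1 + r - 1 : ℕ) : ℤ) +
      ∑ s ∈ Finset.range (k + 1), (k.choose s : ℝ) *
        ∑ hh ∈ Finset.HasAntidiagonal.antidiagonal r,
          (s * (excessCount hh.1 s : ℝ)) * ((k - s : ℕ) * (excessCount hh.2 (k - s) : ℝ)) := by
  have h := two_mul_mul_connectedCount_le k (k - 1 + r - 1)
  have e : k - 1 + r - 1 + 1 = k - 1 + r := by omega
  have h2 : ∀ s ∈ Finset.range (k + 1), k.choose s * (s * (k - s) *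
        ∑ ij ∈ Finset.HasAntidiagonal.antidiagonal (k - 1 + r - 1),
          connectedCount s ij.1 * connectedCount (k - s) ij.2) =
      k.choose s * ∑ hh ∈ Finset.HasAntidiagonal.antidiagonal r,
        (s * excessCount hh.1 s) * ((k - s) * excessCount hh.2 (k - s)) := by
    intro s hs
    have hs : s ≤ k := by simpa [Nat.lt_succ_iff] using hs
    rcases Nat.eq_zero_or_pos s with rfl | h0
    · simp
    rcases hs.eq_or_lt with rfl | hlt
    · simp
    have e2 : k - 1 + r - 1 = s - 1 + (k - s - 1) + r := by omega
    rw [e2, sum_antidiagonal_connectedCount h0.ne' (by omega), Finset.mul_sum]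
    congr 1
    refine Finset.sum_congr rfl fun hh _ => ?_
    ring
  rw [Finset.sum_congr rfl h2, e] at h
  have e3 : excessCount r k = connectedCount k ((k - 1 + r : ℕ) : ℤ) := by
    simp [excessCount, hk]
  rw [e3]
  have h' := (Nat.cast_le (α := ℝ)).2 h
  push_cast at h'
  push_cast
  exact h'

/-- The edge deletion recursion for generating functions. The factor `2 m` of the left side, where
`m ≥ k` is the number of edges, is replaced by `2 k`, which turns connected graphs into rooted
ones. -/
lemma excessSeries_recursion (r : ℕ) :
    Dominated ((2 : ℝ) • excessSeries (r + 1)) (theta (excessSeries r) +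
      ∑ hh ∈ Finset.HasAntidiagonal.antidiagonal (r + 1),
        excessSeries hh.1 * excessSeries hh.2) := by
  intro k
  have hk! : (0 : ℝ) < k ! := by positivity
  rcases Nat.eq_zero_or_pos k with rfl | hk
  · have h0 : ∀ r, coeff 0 (excessSeries r) = 0 := by intro r; simp [excessSeries]
    simp only [map_add, map_sum, coeff_theta, PowerSeries.coeff_smul, coeff_mul, h0]
    simp [h0]
  have h := two_mul_excessCount_le (r := r + 1) hk.ne' (by omega)
  rw [Finset.sum_congr rfl (fun s _ => Finset.mul_sum _ _ _), Finset.sum_comm] at h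
  have h2 : ∀ hh ∈ Finset.HasAntidiagonal.antidiagonal (r + 1),
      ∑ s ∈ Finset.range (k + 1), (k.choose s : ℝ) * ((s * (excessCount hh.1 s : ℝ)) *
        ((k - s : ℕ) * (excessCount hh.2 (k - s) : ℝ))) =
      (k ! : ℝ) * coeff k (excessSeries hh.1 * excessSeries hh.2) := by
    intro hh _
    rw [excessSeries, excessSeries, factorial_mul_coeff_mul]
    refine Finset.sum_congr rfl fun s _ => ?_
    ring
  rw [Finset.sum_congr rfl h2, ← Finset.mul_sum] at h
  rw [map_add, map_sum, PowerSeries.coeff_smul, smul_eq_mul, coeff_theta]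
  refine le_of_mul_le_mul_left ?_ hk!
  rw [mul_add]
  have e5 : connectedCount k ((k - 1 + (r + 1) - 1 : ℕ) : ℤ) = excessCount r k := by
    simp only [excessCount, if_neg hk.ne']
    congr 2
  rw [e5] at h
  have e6 : (k ! : ℝ) * (k * coeff k (excessSeries r)) = k * k * excessCount r k := by
    rw [excessSeries, coeff_mk]
    field_simp
  have e7 : (k ! : ℝ) * (2 * coeff k (excessSeries (r + 1))) = 2 * k * excessCount (r + 1) k := by
    rw [excessSeries, coeff_mk]
    field_simp
  rw [e6, e7]
  refine le_trans ?_ (h.trans (add_le_add_left ?_ _))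
  · have : (k : ℝ) ≤ ((k - 1 + (r + 1) : ℕ) : ℝ) := by exact_mod_cast (by omega)
    gcongr
  · have : ((k - 1 : ℕ) : ℝ) ≤ k := by exact_mod_cast (by omega)
    gcongr

/-- There are at most `k ^ (k - 1)` rooted labelled trees, written as in `abel_identity`. -/
lemma excessCount_zero_le (k : ℕ) : (k * excessCount 0 k : ℝ) ≤ k * (k : ℝ) ^ (k - 2) := by
  induction k using Nat.strong_induction_on with
  | _ k ih =>
    rcases Nat.lt_or_ge k 2 with hk | hk
    · interval_cases k
      · simp
      · have := connectedCount_one_zero_le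
        simp only [excessCount, one_ne_zero, if_false]
        norm_num
        simpa using this
    have h := two_mul_excessCount_le (k := k) (r := 0) (by omega) (by omega)
    rw [connectedCount_eq_zero (k := k) (m := ((k - 1 + 0 - 1 : ℕ) : ℤ)) (by omega)] at h
    simp only [Finset.Nat.antidiagonal_zero, Finset.sum_singleton, Nat.cast_zero, mul_zero,
      zero_add, add_zero] at h
    have h2 : ∑ s ∈ Finset.range (k + 1), (k.choose s : ℝ) *
          ((s * (excessCount 0 s : ℝ)) * ((k - s : ℕ) * (excessCount 0 (k - s) : ℝ))) ≤
        ∑ s ∈ Finset.range (k + 1), (k.choose s : ℝ) * (s * (s : ℝ) ^ (s - 2)) *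
          ((k - s : ℕ) * ((k - s : ℕ) : ℝ) ^ (k - s - 2)) := by
      refine Finset.sum_le_sum fun s hs => ?_
      have hs : s ≤ k := by simpa [Nat.lt_succ_iff] using hs
      rw [mul_assoc (k.choose s : ℝ)]
      refine mul_le_mul_of_nonneg_left ?_ (Nat.cast_nonneg _)
      rcases Nat.eq_zero_or_pos s with rfl | h0
      · simp
      rcases hs.eq_or_lt with rfl | hlt
      · simp
      exact mul_le_mul (ih s hlt) (ih (k - s) (by omega)) (by positivity) (by positivity)
    have h3 := h.trans h2
    rw [← factorial_mul_coeff_mul (fun s => s * (s : ℝ) ^ (s - 2))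
      (fun s => s * (s : ℝ) ^ (s - 2))] at h3
    have h4 := coeff_treeSeries_sq k
    rw [pow_two] at h4
    rw [treeSeries, coeff_mk] at h4
    have hk0 : (0 : ℝ) < k := by exact_mod_cast (by omega)
    have hk1 : (0 : ℝ) < k - 1 := by
      have : (2 : ℝ) ≤ k := by exact_mod_cast hk
      linarith
    have h5 := mul_le_mul_of_nonneg_left h3 hk0.le
    rw [mul_left_comm (k : ℝ) (k ! : ℝ), h4] at h5
    have e : ((k - 1 : ℕ) : ℝ) = k - 1 := by
      rw [Nat.cast_sub (by omega)]; simp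
    rw [e] at h5
    have hk! : (k ! : ℝ) ≠ 0 := by positivity
    have e2 : (k ! : ℝ) * (2 * (k - 1) * (k * (k : ℝ) ^ (k - 2) / k !)) =
      (2 * (k - 1)) * (k * (k : ℝ) ^ (k - 2)) := by field_simp
    rw [e2] at h5
    refine le_of_mul_le_mul_left (a := 2 * ((k : ℝ) - 1)) ?_ (by positivity)
    linarith

lemma excessSeries_zero_le : Dominated (excessSeries 0) treeSeries := fun k => by
  rw [excessSeries, treeSeries, coeff_mk, coeff_mk]
  exact div_le_div_of_nonneg_right (excessCount_zero_le k) (by positivity)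

/-- A Wright type bound: the generating function for cyclomatic number `l + 1` is dominated by a
multiple of `(1 - T) ^ (-(3 l + 2))`. The terms of the recursion that contain a tree are moved to
the left side, which costs one factor `(1 - T)⁻¹`. -/
lemma excessSeries_succ_le (l : ℕ) :
    Dominated (excessSeries (l + 1))
      ((1 / 2 * (7 / 4 : ℝ) ^ l * l !) • mapSeries ^ (3 * l + 2)) := by
  induction l using Nat.strong_induction_on with
  | _ l ih =>
    have hT : ∀ r, Dominated (excessSeries 0 * excessSeries r) (treeSeries * excessSeries r) :=
      fun r => Dominated.mul (excessSeries_nonneg r) treeSeries_nonneg excessSeries_zero_le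
        (fun n => le_rfl)
    rcases l with _ | l
    · have h := excessSeries_recursion 0
      have h1 : Dominated (excessSeries 1) ((1 / 2 : ℝ) • mapSeries + treeSeries * excessSeries 1)
          := by
        intro n
        have h2 := h n
        have h3 := hT 1 n
        have h4 := excessSeries_zero_le.theta n
        rw [theta_treeSeries] at h4
        have h5 : coeff n (1 : ℝ⟦X⟧) ≥ 0 := by rw [coeff_one]; split_ifs <;> norm_num
        rw [Finset.Nat.antidiagonal_succ] at h2
        simp only [Finset.Nat.antidiagonal_zero, Finset.map_singleton, Finset.sum_cons,
          Finset.sum_singleton, map_add, PowerSeries.coeff_smul, smul_eq_mul, map_sub,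
          Function.Embedding.prodMap, Function.Embedding.coeFn_mk, Prod.map] at h2 h4 ⊢
        simp only [Nat.succ_eq_add_one, zero_add, Function.Embedding.refl_apply] at h2
        rw [mul_comm (excessSeries 1)] at h2
        linarith
      have h6 := dominated_mul_mapSeries h1
      intro n
      have h7 := h6 n
      rw [mul_smul_comm, ← pow_two] at h7
      simpa using h7
    · have h := excessSeries_recursion (l + 1)
      set c : ℕ → ℝ := fun l => 1 / 2 * (7 / 4 : ℝ) ^ l * l ! with hc
      have hc0 : ∀ l, 0 ≤ c l := fun l => by positivity
      have h1 : Dominated (excessSeries (l + 2)) (c (l + 1) • mapSeries ^ (3 * l + 4) +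
          treeSeries * excessSeries (l + 2)) := by
        intro n
        have h2 := h n
        have h3 := hT (l + 2) n
        have h4 : coeff n (theta (excessSeries (l + 1))) ≤
            coeff n (c l • (((3 * l + 1 + 1 : ℕ) : ℝ) • mapSeries ^ (3 * l + 4))) := by
          refine ((ih l (Nat.lt_succ_self l)).theta n).trans ?_
          refine le_trans (le_of_eq ?_) ((theta_mapSeries_pow_le (3 * l + 1)).smul (hc0 l) n)
          simp only [coeff_theta, PowerSeries.coeff_smul, smul_eq_mul, hc]
          ring
        have h5 : ∀ ij ∈ Finset.HasAntidiagonal.antidiagonal l,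
            coeff n (excessSeries (ij.1 + 1) * excessSeries (ij.2 + 1)) ≤
            1 / 4 * (7 / 4 : ℝ) ^ l * l ! * coeff n (mapSeries ^ (3 * l + 4)) := by
          intro ij hij
          have hij := Finset.HasAntidiagonal.mem_antidiagonal.1 hij
          have h6 := Dominated.mul (excessSeries_nonneg (ij.2 + 1))
            ((mapSeries_pow_nonneg (3 * ij.1 + 2)).smul (hc0 ij.1) |>
              fun h n => by simpa using h n)
            (ih ij.1 (by omega)) (ih ij.2 (by omega)) n
          refine h6.trans ?_
          rw [smul_mul_smul_comm, ← pow_add, PowerSeries.coeff_smul, smul_eq_mul,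
            show 3 * ij.1 + 2 + (3 * ij.2 + 2) = 3 * l + 4 by omega]
          have h7 := mapSeries_pow_nonneg (3 * l + 4) n
          rw [map_zero] at h7
          refine mul_le_mul_of_nonneg_right ?_ h7
          have h8 : (ij.1 ! * ij.2 ! : ℝ) ≤ l ! := by
            rw [← hij]
            exact_mod_cast Nat.le_of_dvd (Nat.factorial_pos _)
              (Nat.factorial_mul_factorial_dvd_factorial_add _ _)
          calc _ = 1 / 4 * (7 / 4 : ℝ) ^ (ij.1 + ij.2) * (ij.1 ! * ij.2 !) := by
                rw [pow_add]; ring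
            _ ≤ _ := by rw [hij]; gcongr
        have h9 := Finset.sum_le_sum h5
        rw [Finset.sum_const, Finset.Nat.card_antidiagonal, nsmul_eq_mul] at h9
        rw [Finset.Nat.antidiagonal_succ_succ'] at h2
        simp only [Finset.sum_cons, Finset.sum_map, map_add, PowerSeries.coeff_smul, smul_eq_mul,
          Function.Embedding.prodMap, Function.Embedding.coeFn_mk, Prod.map, map_sum,
          Nat.succ_eq_add_one] at h2 h4 ⊢
        rw [mul_comm (excessSeries (l + 1 + 1))] at h2
        have h10 := mapSeries_pow_nonneg (3 * l + 4) n
        rw [map_zero] at h10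
        -- `(3 l + 2) / 2 + (l + 1) / 4 ≤ 7 / 4 * (l + 1)`: this is where `7 / 4` comes from
        have h11 : 1 / 2 * (c l * ((3 * l + 1 + 1 : ℕ) : ℝ)) + 1 / 2 * (((l + 1 : ℕ) : ℝ) *
            (1 / 4 * (7 / 4 : ℝ) ^ l * l !)) ≤ c (l + 1) := by
          simp only [hc, Nat.factorial_succ, pow_succ]
          push_cast
          have : (0 : ℝ) ≤ (7 / 4 : ℝ) ^ l * l ! := by positivity
          nlinarith [this]
        have h12 := mul_le_mul_of_nonneg_right h11 h10
        linarith
      have h6 := dominated_mul_mapSeries h1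
      intro n
      have h7 := h6 n
      rw [mul_smul_comm, ← pow_succ'] at h7
      exact h7

end Excess

/-! ### Connected graphs of small excess -/

section Coefficients

open PowerSeries Real
open scoped Nat

lemma factorial_le_stirling {n : ℕ} (hn : n ≠ 0) :
    (n ! : ℝ) ≤ exp 1 * √n * (n / exp 1) ^ n := by
  have h := Stirling.stirlingSeq'_antitone (Nat.zero_le (n - 1))
  simp only [Function.comp_apply, Nat.succ_eq_add_one, zero_add,
    Nat.sub_add_cancel (Nat.one_le_iff_ne_zero.2 hn), Stirling.stirlingSeq] at h
  have hn0 : (0 : ℝ) < n := by exact_mod_cast Nat.pos_of_ne_zero hn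
  rw [div_le_iff₀ (by positivity)] at h
  refine h.trans (le_of_eq ?_)
  rw [sqrt_mul (by norm_num) (n : ℝ), Nat.factorial_one, Nat.cast_one, mul_one]
  field_simp

lemma pow_self_div_factorial_le {n : ℕ} (hn : n ≠ 0) :
    (n : ℝ) ^ n / n ! ≤ exp n / √n := by
  have hn0 : (0 : ℝ) < n := by exact_mod_cast Nat.pos_of_ne_zero hn
  have h := Stirling.le_factorial_stirling n
  rw [div_le_div_iff₀ (by positivity) (by positivity)]
  have h1 : √(n : ℝ) ≤ √(2 * π * n) := by
    apply sqrt_le_sqrt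
    nlinarith [pi_gt_three]
  have h2 : √(n : ℝ) * (n / exp 1) ^ n ≤ n ! :=
    le_trans (mul_le_mul_of_nonneg_right h1 (by positivity)) h
  rw [div_pow, ← exp_nat_mul, mul_one, mul_div_assoc', div_le_iff₀ (exp_pos _)] at h2
  linarith

lemma sum_inv_sqrt_le (n : ℕ) : ∑ s ∈ Finset.range n, 1 / √((s : ℝ) + 1) ≤ 2 * √n := by
  induction n with
  | zero => simp
  | succ n ih =>
    rw [Finset.sum_range_succ]
    push_cast
    set a := √(n : ℝ) with ha
    set b := √((n : ℝ) + 1) with hb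
    have ha0 : 0 ≤ a := sqrt_nonneg _
    have hb0 : 0 < b := sqrt_pos.2 (by positivity)
    have ha2 : a ^ 2 = n := sq_sqrt (by positivity)
    have hb2 : b ^ 2 = n + 1 := sq_sqrt (by positivity)
    have : 1 / b ≤ 2 * b - 2 * a := by
      rw [div_le_iff₀ hb0]
      nlinarith [sq_nonneg (a - b)]
    linarith

/-- The larger of `a` and `b` is at least `(a + b) / 2`; this decouples a convolution. -/
lemma inv_sqrt_mul_sqrt_le {a b : ℝ} (ha : 0 < a) (hb : 0 < b) :
    1 / (√a * √b) ≤ √2 / √(a + b) * (1 / √a + 1 / √b) := by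
  have key : ∀ {a b : ℝ}, 0 < a → a ≤ b → 1 / (√a * √b) ≤ √2 / √(a + b) * (1 / √a + 1 / √b) := by
    intro a b ha hab
    have hb := ha.trans_le hab
    have h1 : 1 / √b ≤ √2 / √(a + b) := by
      rw [div_le_div_iff₀ (sqrt_pos.2 hb) (sqrt_pos.2 (by positivity)), one_mul,
        ← sqrt_mul (by norm_num)]
      exact sqrt_le_sqrt (by linarith)
    calc 1 / (√a * √b) = 1 / √b * (1 / √a) := by rw [mul_comm, one_div_mul_one_div]
      _ ≤ √2 / √(a + b) * (1 / √a) := by gcongr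
      _ ≤ _ := by gcongr; have : 0 ≤ 1 / √b := by positivity
                  linarith
  rcases le_total a b with h | h
  · exact key ha h
  · have := key hb h
    rwa [mul_comm (√b), add_comm b, add_comm (1 / √b)] at this

/-- `k!` times the coefficient of `x ^ k` in `(1 - T) ^ (-a)`. -/
noncomputable def mapCoeff (a k : ℕ) : ℝ := k ! * coeff k (mapSeries ^ a)

lemma mapCoeff_one (k : ℕ) : mapCoeff 1 k = (k : ℝ) ^ k := by
  rw [mapCoeff, pow_one, mapSeries, coeff_mk]
  field_simp

lemma mapCoeff_two_le {k : ℕ} (hk : k ≠ 0) : mapCoeff 2 k ≤ 20 * ((k : ℝ) ^ k * √k) := by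
  have hk0 : (0 : ℝ) < k := by exact_mod_cast Nat.pos_of_ne_zero hk
  have hk1 : (1 : ℝ) ≤ k := by exact_mod_cast Nat.pos_of_ne_zero hk
  have hsk : 1 ≤ √(k : ℝ) := one_le_sqrt.2 hk1
  obtain ⟨j, rfl⟩ := Nat.exists_eq_succ_of_ne_zero hk
  rw [Nat.succ_eq_add_one] at *
  set k := j + 1 with hkj
  have h1 : mapCoeff 2 k = 2 * (k : ℝ) ^ k + ∑ i ∈ Finset.range j, (k.choose (i + 1) : ℝ) *
      ((i + 1 : ℕ) : ℝ) ^ (i + 1) * ((k - (i + 1) : ℕ) : ℝ) ^ (k - (i + 1)) := by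
    rw [mapCoeff, pow_two, mapSeries, factorial_mul_coeff_mul, Finset.sum_range_succ, hkj,
      Finset.sum_range_succ']
    simp
    ring
  have h2 : ∀ i ∈ Finset.range j, (k.choose (i + 1) : ℝ) *
      ((i + 1 : ℕ) : ℝ) ^ (i + 1) * ((k - (i + 1) : ℕ) : ℝ) ^ (k - (i + 1)) ≤
      (k ! * exp k * (√2 / √k)) * (1 / √((i : ℝ) + 1) + 1 / √(((j - 1 - i : ℕ) : ℝ) + 1)) := by
    intro i hi
    have hi := Finset.mem_range.1 hi
    set t := k - (i + 1) with ht
    have ht0 : t ≠ 0 := by omega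
    have e1 : ((j - 1 - i : ℕ) : ℝ) + 1 = t := by
      rw [← Nat.cast_add_one]; congr 1; omega
    have e2 : ((i + 1 : ℕ) : ℝ) + t = k := by rw [← Nat.cast_add]; congr 1; omega
    have e3 : (i : ℝ) + 1 = ((i + 1 : ℕ) : ℝ) := by push_cast; ring
    rw [e1, e3]
    set s := i + 1 with hs
    have hs0 : s ≠ 0 := by omega
    have ht1 : (0 : ℝ) < t := by exact_mod_cast Nat.pos_of_ne_zero ht0
    have hs1 : (0 : ℝ) < s := by exact_mod_cast Nat.pos_of_ne_zero hs0
    rw [Nat.cast_choose ℝ (show s ≤ k by omega)]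
    calc _ = k ! * (((s : ℝ) ^ s / s !) * ((t : ℝ) ^ t / t !)) := by
          rw [← ht]; field_simp
      _ ≤ k ! * ((exp s / √s) * (exp t / √t)) := by
          have a := pow_self_div_factorial_le hs0
          have b := pow_self_div_factorial_le ht0
          gcongr
      _ = k ! * exp k * (1 / (√s * √t)) := by
          rw [← e2, exp_add]; field_simp
      _ ≤ k ! * exp k * (√2 / √k * (1 / √s + 1 / √t)) := by
          have := inv_sqrt_mul_sqrt_le hs1 ht1
          rw [e2] at this
          gcongr
      _ = _ := by ring
  have h3 := Finset.sum_le_sum h2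
  rw [← Finset.mul_sum, Finset.sum_add_distrib,
    Finset.sum_range_reflect (fun i => 1 / √((i : ℝ) + 1))] at h3
  have h4 := sum_inv_sqrt_le j
  have h5 : √(j : ℝ) ≤ √(k : ℝ) := sqrt_le_sqrt (by rw [hkj]; push_cast; linarith)
  have h6 := factorial_le_stirling hk
  rw [div_pow, ← exp_nat_mul, mul_one] at h6
  have h7 : (k ! : ℝ) * exp k ≤ exp 1 * √k * (k : ℝ) ^ k := by
    rw [mul_div_assoc', le_div_iff₀ (exp_pos _)] at h6
    exact h6
  have h8 : (k ! * exp k * (√2 / √k)) * (∑ i ∈ Finset.range j, 1 / √((i : ℝ) + 1) +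
      ∑ i ∈ Finset.range j, 1 / √((i : ℝ) + 1)) ≤ (exp 1 * √k * (k : ℝ) ^ k * (√2 / √k)) *
      (4 * √k) := by
    gcongr
    linarith
  have h9 : (exp 1 * √k * (k : ℝ) ^ k * (√2 / √k)) * (4 * √k) =
      4 * exp 1 * √2 * ((k : ℝ) ^ k * √k) := by
    field_simp
  have h10 : exp 1 < 3 := exp_one_lt_three
  have h11 : √2 ≤ 3 / 2 := by
    rw [sqrt_le_left (by norm_num)]; norm_num
  have h12 : (k : ℝ) ^ k ≤ (k : ℝ) ^ k * √k := le_mul_of_one_le_right (by positivity) hsk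
  have h13 : 4 * exp 1 * √2 ≤ 18 := by
    calc 4 * exp 1 * √2 ≤ 4 * 3 * (3 / 2) := by gcongr
      _ = 18 := by norm_num
  have h14 : 4 * exp 1 * √2 * ((k : ℝ) ^ k * √k) ≤ 18 * ((k : ℝ) ^ k * √k) := by gcongr
  rw [h1]
  linarith

/-- The coefficients of `theta (U ^ (a + 1)) = (a + 1) (U ^ (a + 3) - U ^ (a + 2))`. -/
lemma mapCoeff_add_three {a k : ℕ} :
    mapCoeff (a + 3) k = mapCoeff (a + 2) k + k / ((a : ℝ) + 1) * mapCoeff (a + 1) k := by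
  have h := congrArg (coeff k) (theta_mapSeries_pow a)
  rw [coeff_theta, show ((a + 1 : ℕ) : ℝ⟦X⟧) = C ((a + 1 : ℕ) : ℝ) by simp, coeff_C_mul,
    map_sub] at h
  push_cast at h
  rw [mapCoeff, mapCoeff, mapCoeff]
  field_simp
  linear_combination -h

/-- The recursion `mapCoeff_add_three` is dominated by its second term as long as `a` is small
compared to `k`; the factor `11 / 10` pays for the first one. -/
lemma mapCoeff_le (k : ℕ) (hk : k ≠ 0) (a : ℕ) (ha : 28 * a ≤ k) :
    mapCoeff (a + 1) k ≤
      20 * (k : ℝ) ^ k * (11 / 10) ^ (a + 1) * √k ^ a / √((a - 1) ! : ℝ) ∧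
    mapCoeff (a + 2) k ≤
      20 * (k : ℝ) ^ k * (11 / 10) ^ (a + 2) * √k ^ (a + 1) / √(a ! : ℝ) := by
  have hk0 : (0 : ℝ) < k := by exact_mod_cast Nat.pos_of_ne_zero hk
  induction a with
  | zero =>
    have h1 : (0 : ℝ) < (k : ℝ) ^ k := by positivity
    have h2 : (0 : ℝ) ≤ (k : ℝ) ^ k * √k := by positivity
    have h3 := mapCoeff_two_le hk
    simp only [zero_add, mapCoeff_one, Nat.factorial, pow_zero, pow_one, Nat.cast_one, sqrt_one]
    constructor <;> norm_num <;> nlinarith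
  | succ a ih =>
    obtain ⟨h1, h2⟩ := ih (by omega)
    refine ⟨by simpa using h2, ?_⟩
    rw [mapCoeff_add_three]
    set r := √(k : ℝ) with hr
    have hr0 : 0 < r := sqrt_pos.2 hk0
    have hr2 : r ^ 2 = k := sq_sqrt hk0.le
    set X := 20 * (k : ℝ) ^ k * (11 / 10) ^ (a + 1) * r ^ (a + 2) / √((a + 1) ! : ℝ) with hX
    have hX0 : 0 ≤ X := by positivity
    have t1 : mapCoeff (a + 2) k ≤ X * (21 / 100) := by
      refine h2.trans ?_
      have e : √((a + 1) ! : ℝ) = √((a : ℝ) + 1) * √(a ! : ℝ) := by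
        rw [Nat.factorial_succ]; push_cast
        rw [sqrt_mul (by positivity)]
      rw [hX, e]
      have e2 : √((a : ℝ) + 1) ≤ r * (189 / 1000) := by
        rw [sqrt_le_left (by positivity), mul_pow, hr2]
        have : (28 * (a + 1) : ℝ) ≤ k := by exact_mod_cast ha
        nlinarith
      have e3 : 0 < √((a : ℝ) + 1) := sqrt_pos.2 (by positivity)
      have e4 : 0 < √(a ! : ℝ) := sqrt_pos.2 (by positivity)
      rw [div_mul_eq_mul_div, div_le_div_iff₀ e4 (by positivity)]
      have e5 : (0 : ℝ) ≤ 20 * (k : ℝ) ^ k * (11 / 10) ^ (a + 1) * r ^ (a + 1) * √(a ! : ℝ) := by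
        positivity
      calc _ = (20 * (k : ℝ) ^ k * (11 / 10) ^ (a + 1) * r ^ (a + 1) * √(a ! : ℝ)) *
            (11 / 10 * √((a : ℝ) + 1)) := by ring
        _ ≤ (20 * (k : ℝ) ^ k * (11 / 10) ^ (a + 1) * r ^ (a + 1) * √(a ! : ℝ)) *
            (r * (21 / 100)) := by
            refine mul_le_mul_of_nonneg_left ?_ e5
            nlinarith
        _ = _ := by ring
    have t2 : k / ((a : ℝ) + 1) * mapCoeff (a + 1) k ≤ X := by
      refine (mul_le_mul_of_nonneg_left h1 (by positivity)).trans ?_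
      have e : √((a + 1) ! : ℝ) ≤ ((a : ℝ) + 1) * √((a - 1) ! : ℝ) := by
        rw [sqrt_le_left (by positivity), mul_pow, sq_sqrt (by positivity)]
        rcases a with _ | a
        · simp
        · rw [Nat.factorial_succ, Nat.factorial_succ]
          simp only [Nat.add_sub_cancel]
          push_cast
          have : (0 : ℝ) < a ! := by positivity
          nlinarith [mul_pos (show (0 : ℝ) < a + 1 + 1 by positivity) this]
      have e4 : 0 < √((a - 1) ! : ℝ) := sqrt_pos.2 (by positivity)
      have e6 : 0 < √((a + 1) ! : ℝ) := sqrt_pos.2 (by positivity)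
      rw [hX, div_mul_div_comm, div_le_div_iff₀ (by positivity) e6]
      calc _ = (20 * (k : ℝ) ^ k * (11 / 10) ^ (a + 1) * (r ^ a * k)) * √((a + 1) ! : ℝ) := by ring
        _ ≤ (20 * (k : ℝ) ^ k * (11 / 10) ^ (a + 1) * (r ^ a * k)) *
            (((a : ℝ) + 1) * √((a - 1) ! : ℝ)) := by gcongr
        _ = _ := by rw [← hr2]; ring
    calc _ ≤ X * (21 / 100) + X := add_le_add t1 t2
      _ = _ := by rw [hX]; ring

/-- The square of the comparison between the constants `(7 / 4) ^ l * l !` of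
`excessSeries_succ_le`, the powers of `11 / 10` of `mapCoeff_le`, and the factorial there. By
Stirling's formula, up to a power of `l`, `(3 l)!` exceeds `(l !) ^ 2 * l ^ l` by a factor
`(27 / e) ^ l`, and `27 / e` is larger than `(7 / 4) ^ 2 * (11 / 10) ^ 6`. -/
lemma pow_mul_factorial_sq_le {l : ℕ} (hl : 1 ≤ l) :
    ((49 / 16 : ℝ) * (11 / 10) ^ 6) ^ l * (l ! : ℝ) ^ 2 * (l : ℝ) ^ l ≤ (3 * l) ! := by
  induction l, hl using Nat.le_induction with
  | base => norm_num [Nat.factorial]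
  | succ l hl ih =>
    have hl0 : (1 : ℝ) ≤ l := by exact_mod_cast hl
    have h1 : ((l : ℝ) + 1) ^ l ≤ 2.7183 * (l : ℝ) ^ l := by
      have e1 : ((l : ℝ) + 1) / l ≤ exp (1 / l) := by
        have := add_one_le_exp (1 / (l : ℝ))
        rw [add_div, div_self (by positivity)]
        linarith
      have e2 := pow_le_pow_left₀ (by positivity) e1 l
      rw [← exp_nat_mul, mul_one_div_cancel (by positivity), div_pow,
        div_le_iff₀ (by positivity)] at e2
      refine e2.trans (mul_le_mul_of_nonneg_right ?_ (by positivity))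
      exact (exp_one_lt_d9.trans (by norm_num)).le
    have e3 : ((3 * (l + 1)) ! : ℝ) =
        (3 * l + 3) * ((3 * l + 2) * ((3 * l + 1) * ((3 * l) ! : ℝ))) := by
      rw [show 3 * (l + 1) = 3 * l + 1 + 1 + 1 by ring, Nat.factorial_succ, Nat.factorial_succ,
        Nat.factorial_succ]
      push_cast
      ring
    rw [e3, pow_succ _ l, Nat.factorial_succ]
    push_cast
    set A : ℝ := (49 / 16 : ℝ) * (11 / 10) ^ 6 with hA
    have hA0 : 0 < A := by positivity
    have hA1 : A ≤ 5.4255 := by rw [hA]; norm_num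
    have hl2 : A * ((l + 1) ^ 3 * 2.7183) ≤ (3 * l + 3) * ((3 * l + 2) * (3 * l + 1)) := by
      have : A * ((l + 1) ^ 3 * 2.7183) ≤ 5.4255 * (((l : ℝ) + 1) ^ 3 * 2.7183) := by gcongr
      nlinarith [mul_nonneg (sub_nonneg.2 hl0) (show (0 : ℝ) ≤ l by linarith),
        mul_nonneg (mul_nonneg (sub_nonneg.2 hl0) (show (0 : ℝ) ≤ l by linarith))
          (show (0 : ℝ) ≤ l by linarith)]
    calc A ^ l * A * ((l + 1) * (l ! : ℝ)) ^ 2 * ((l : ℝ) + 1) ^ (l + 1)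
        = (A ^ l * (l ! : ℝ) ^ 2) * (A * (l + 1) ^ 3) * ((l : ℝ) + 1) ^ l := by ring
      _ ≤ (A ^ l * (l ! : ℝ) ^ 2) * (A * (l + 1) ^ 3) * (2.7183 * (l : ℝ) ^ l) := by gcongr
      _ = (A ^ l * (l ! : ℝ) ^ 2 * (l : ℝ) ^ l) * (A * ((l + 1) ^ 3 * 2.7183)) := by ring
      _ ≤ ((3 * l) ! : ℝ) * ((3 * l + 3) * ((3 * l + 2) * (3 * l + 1))) := by gcongr
      _ = _ := by ring

/-- The bound on the number of connected graphs for small excess. -/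
lemma connectedCount_le_of_small {k l : ℕ} (hk : k ≠ 0) (h : 84 * l ≤ k) :
    (connectedCount k ((k + l : ℕ) : ℤ) : ℝ) ≤
      20 * ((k : ℝ) ^ k / √k * √k ^ (3 * l) / √((l : ℝ) ^ l)) := by
  have hk0 : (0 : ℝ) < k := by exact_mod_cast Nat.pos_of_ne_zero hk
  set r := √(k : ℝ) with hr
  have hr0 : 0 < r := sqrt_pos.2 hk0
  have hr2 : r ^ 2 = k := sq_sqrt hk0.le
  have h1 := excessSeries_succ_le l k
  rw [excessSeries, coeff_mk, PowerSeries.coeff_smul, smul_eq_mul] at h1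
  have h2 := (mapCoeff_le k hk (3 * l) (by omega)).2
  have e1 : excessCount (l + 1) k = connectedCount k ((k + l : ℕ) : ℤ) := by
    rw [excessCount, if_neg hk]
    congr 2
    omega
  rw [e1, div_le_iff₀ (by positivity)] at h1
  have e2 : 1 / 2 * (7 / 4 : ℝ) ^ l * l ! * coeff k (mapSeries ^ (3 * l + 2)) * k ! =
      1 / 2 * (7 / 4 : ℝ) ^ l * l ! * mapCoeff (3 * l + 2) k := by
    rw [mapCoeff]; ring
  rw [e2] at h1
  have h3 := h1.trans (mul_le_mul_of_nonneg_left h2 (by positivity))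
  have h4 : (7 / 4 : ℝ) ^ l * l ! * (11 / 10) ^ (3 * l) * √((l : ℝ) ^ l) ≤ √((3 * l) ! : ℝ) := by
    apply le_sqrt_of_sq_le
    rcases Nat.eq_zero_or_pos l with rfl | hl
    · simp
    refine le_trans (le_of_eq ?_) (pow_mul_factorial_sq_le hl)
    rw [mul_pow, sq_sqrt (by positivity), mul_pow, mul_pow, mul_pow, ← pow_mul, ← pow_mul,
      ← pow_mul, show (49 / 16 : ℝ) = (7 / 4) ^ 2 by norm_num, ← pow_mul, mul_comm l 2,
      show 3 * l * 2 = 6 * l by ring]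
    ring
  have hl0 : 0 < √((l : ℝ) ^ l) := by
    rcases Nat.eq_zero_or_pos l with rfl | hl
    · simp
    · exact sqrt_pos.2 (by positivity)
  have hf0 : 0 < √((3 * l) ! : ℝ) := sqrt_pos.2 (by positivity)
  refine le_of_mul_le_mul_left (h3.trans ?_) hk0
  calc _ = 10 * (121 / 100) * ((k : ℝ) ^ k * r ^ (3 * l + 1)) *
        ((7 / 4 : ℝ) ^ l * l ! * (11 / 10) ^ (3 * l)) / √((3 * l) ! : ℝ) := by ring
    _ ≤ 10 * (121 / 100) * ((k : ℝ) ^ k * r ^ (3 * l + 1)) / √((l : ℝ) ^ l) := by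
        rw [div_le_div_iff₀ hf0 hl0, mul_assoc]
        exact mul_le_mul_of_nonneg_left h4 (by positivity)
    _ ≤ 20 * ((k : ℝ) ^ k * r ^ (3 * l + 1)) / √((l : ℝ) ^ l) := by
        gcongr
        norm_num
    _ = _ := by rw [← hr2]; field_simp; ring

/-- The bound on the number of labelled trees. -/
lemma connectedCount_tree_le {k : ℕ} (hk : k ≠ 0) :
    (connectedCount k ((k : ℤ) + -1) : ℝ) ≤ (k : ℝ) ^ k / (k : ℝ) ^ 2 := by
  have hk0 : (0 : ℝ) < k := by exact_mod_cast Nat.pos_of_ne_zero hk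
  have h := le_of_mul_le_mul_left (excessCount_zero_le k) hk0
  have e1 : excessCount 0 k = connectedCount k ((k : ℤ) + -1) := by
    rw [excessCount, if_neg hk]
    congr 1
    omega
  rw [e1] at h
  refine h.trans ?_
  rcases Nat.lt_or_ge k 2 with h | h
  · obtain rfl : k = 1 := by omega
    simp
  · rw [le_div_iff₀ (by positivity), ← pow_add, Nat.sub_add_cancel h]

end Coefficients

/-! ### Connected graphs of large excess -/

section LargeExcess

open Real
open scoped Nat

/-- Termwise comparison of the power series: `6 ^ n * n ! ≤ (2 n + 1)!`. -/
lemma sinh_le_mul_exp {t : ℝ} (ht : 0 ≤ t) : sinh t ≤ t * exp (t ^ 2 / 6) := by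
  have h1 := hasSum_sinh t
  have h2 : HasSum (fun n : ℕ => t * ((t ^ 2 / 6) ^ n / n !)) (t * exp (t ^ 2 / 6)) := by
    refine HasSum.mul_left _ ?_
    have := NormedSpace.expSeries_div_hasSum_exp (t ^ 2 / 6)
    rwa [← exp_eq_exp_ℝ] at this
  refine hasSum_le (fun n => ?_) h1 h2
  have h3 : (6 : ℝ) ^ n * n ! ≤ (2 * n + 1)! := by
    induction n with
    | zero => simp
    | succ n ih =>
      rw [show 2 * (n + 1) + 1 = 2 * n + 1 + 1 + 1 by ring, Nat.factorial_succ (2 * n + 1 + 1),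
        Nat.factorial_succ (2 * n + 1), Nat.factorial_succ n]
      push_cast
      have : (0 : ℝ) ≤ 6 ^ n * n ! := by positivity
      calc _ = (6 * (n + 1)) * ((6 : ℝ) ^ n * n !) := by ring
        _ ≤ ((2 * n + 1 + 1 + 1) * (2 * n + 1 + 1)) * ((2 * n + 1)! : ℝ) := by
            refine mul_le_mul ?_ ih this (by positivity)
            nlinarith [(Nat.cast_nonneg n : (0 : ℝ) ≤ n)]
        _ = _ := by ring
  calc t ^ (2 * n + 1) / ((2 * n + 1)! : ℝ) ≤ t ^ (2 * n + 1) / (6 ^ n * n !) := by gcongr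
    _ = _ := by rw [pow_succ, pow_mul, div_pow]; field_simp

lemma one_sub_exp_neg_le {L : ℝ} (hL : 0 ≤ L) :
    1 - exp (-L) ≤ L * exp (-L / 2) * exp (L ^ 2 / 24) := by
  have h := sinh_le_mul_exp (t := L / 2) (by positivity)
  rw [sinh_eq] at h
  have e1 : 1 - exp (-L) = 2 * exp (-L / 2) * ((exp (L / 2) - exp (-(L / 2))) / 2) := by
    have a : exp (-L / 2) * exp (L / 2) = 1 := by rw [← exp_add]; simp; ring
    have b : exp (-L / 2) * exp (-(L / 2)) = exp (-L) := by rw [← exp_add]; congr 1; ring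
    linear_combination b - a
  rw [e1]
  refine (mul_le_mul_of_nonneg_left h (by positivity)).trans (le_of_eq ?_)
  rw [show (L / 2) ^ 2 / 6 = L ^ 2 / 24 by ring]
  ring

lemma le_one_sub_exp_neg {x : ℝ} (hx : 0 ≤ x) : x * exp (-x / 2) ≤ 1 - exp (-x) := by
  have h := self_le_sinh_iff.2 (show 0 ≤ x / 2 by positivity)
  rw [sinh_eq] at h
  have e1 : 1 - exp (-x) = 2 * exp (-x / 2) * ((exp (x / 2) - exp (-(x / 2))) / 2) := by
    have a : exp (-x / 2) * exp (x / 2) = 1 := by rw [← exp_add]; simp; ring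
    have b : exp (-x / 2) * exp (-(x / 2)) = exp (-x) := by rw [← exp_add]; congr 1; ring
    linear_combination b - a
  rw [e1]
  have := mul_le_mul_of_nonneg_left h (show 0 ≤ 2 * exp (-x / 2) by positivity)
  linarith

lemma le_choose_two_of_connectedCount_ne_zero {k m : ℕ} (h : connectedCount k m ≠ 0) :
    m ≤ k.choose 2 := by
  rw [connectedCount_natCast] at h
  obtain ⟨G, -, hm⟩ := Set.nonempty_of_ncard_ne_zero h
  have := ncard_edgeSet_le_choose G
  rwa [hm, Nat.card_fin] at this

/-- The probability that a fixed vertex of `G(k + j, p)` lies in a component with `k` vertices and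
`m` edges is at most one. -/
lemma choose_mul_connectedCount_le_one (k m j : ℕ) (hk : k ≠ 0) (p : unitInterval)
    (hm : m ≤ k.choose 2) :
    ((k - 1 + j).choose (k - 1) : ℝ) * (connectedCount k m * (p : ℝ) ^ m *
      (1 - p : ℝ) ^ (k.choose 2 - m)) * ((1 - p : ℝ) ^ k) ^ j ≤ 1 := by
  have h := mul_expectedCount_le (k + j) p k m
  rw [expectedCount_eq] at h
  have e1 : k.choose 2 + k * (k + j - k) - m = (k.choose 2 - m) + k * j := by
    rw [Nat.add_sub_cancel_left]; omega
  rw [e1, pow_add, pow_mul] at h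
  have e2 : (k : ℝ) * (k + j).choose k = (k + j : ℕ) * (k - 1 + j).choose (k - 1) := by
    obtain ⟨i, rfl⟩ := Nat.exists_eq_succ_of_ne_zero hk
    have := Nat.add_one_mul_choose_eq (i + j) i
    rw [show i + j + 1 = i + 1 + j by ring] at this
    simp only [Nat.succ_eq_add_one, Nat.add_sub_cancel]
    rw [mul_comm]
    exact_mod_cast this.symm
  have hkj : (0 : ℝ) < (k + j : ℕ) := by exact_mod_cast (by omega)
  refine le_of_mul_le_mul_left ?_ hkj
  rw [mul_one]
  refine le_trans (le_of_eq ?_) h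
  linear_combination (-(connectedCount k m * (p : ℝ) ^ m *
      (1 - p : ℝ) ^ (k.choose 2 - m)) * ((1 - p : ℝ) ^ k) ^ j) * e2

/-- A bound on the probability of connectedness with a given number of edges, from summing
`choose_mul_connectedCount_le_one` against a geometric series. -/
lemma connectedCount_mul_le {k m : ℕ} (hk : k ≠ 0) (p : unitInterval) (hm : m ≤ k.choose 2)
    {t : ℝ} (ht0 : 0 ≤ t) (ht1 : t < 1) :
    (connectedCount k m * (p : ℝ) ^ m * (1 - p : ℝ) ^ (k.choose 2 - m)) * (1 - t) ≤
      (1 - (1 - p : ℝ) ^ k * t) ^ k := by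
  set D := (connectedCount k m * (p : ℝ) ^ m * (1 - p : ℝ) ^ (k.choose 2 - m)) with hD
  set z := (1 - p : ℝ) ^ k with hz
  have hp0 : 0 ≤ 1 - (p : ℝ) := sub_nonneg.2 p.2.2
  have hp1 : 1 - (p : ℝ) ≤ 1 := by linarith [p.2.1]
  have hz0 : 0 ≤ z := by positivity
  have hz1 : z ≤ 1 := pow_le_one₀ hp0 hp1
  have hzt : z * t < 1 := by nlinarith
  have hzt' : ‖z * t‖ < 1 := by rwa [norm_of_nonneg (by positivity)]
  have h1 : HasSum (fun j : ℕ => D * (((j + (k - 1)).choose (k - 1) : ℝ) * (z * t) ^ j))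
      (D * (1 / (1 - z * t) ^ (k - 1 + 1))) := by
    refine HasSum.mul_left _ ?_
    rw [← tsum_choose_mul_geometric_of_norm_lt_one (k - 1) hzt']
    exact (summable_choose_mul_geometric_of_norm_lt_one (k - 1) hzt').hasSum
  have h2 := hasSum_geometric_of_lt_one ht0 ht1
  have h3 := hasSum_le (fun j => ?_) h1 h2
  · rw [Nat.sub_add_cancel (Nat.one_le_iff_ne_zero.2 hk), mul_one_div,
      div_le_iff₀ (pow_pos (by linarith) k), inv_mul_eq_div, le_div_iff₀ (by linarith)] at h3
    exact h3
  · have h4 := choose_mul_connectedCount_le_one k m j hk p hm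
    rw [← hD, ← hz] at h4
    calc D * (((j + (k - 1)).choose (k - 1) : ℝ) * (z * t) ^ j)
        = (((k - 1 + j).choose (k - 1) : ℝ) * D * z ^ j) * t ^ j := by
          rw [mul_pow, add_comm j]; ring
      _ ≤ 1 * t ^ j := by gcongr
      _ = t ^ j := one_mul _

/-- A bound on the number of connected graphs of any excess, with a free parameter `L`; the edge
probability behind it is `p = 1 - exp (-L / k)`. -/
lemma connectedCount_le_exp {k l : ℕ} (hk : k ≠ 0) {L : ℝ} (hL : 0 < L) :
    (connectedCount k ((k + l : ℕ) : ℤ) : ℝ) ≤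
      exp 1 * (1 + k / L) * ((k : ℝ) ^ (k + l) / L ^ l) * exp (k * L ^ 2 / 24) := by
  by_cases hC : connectedCount k ((k + l : ℕ) : ℤ) = 0
  · rw [hC, Nat.cast_zero]; positivity
  have hm := le_choose_two_of_connectedCount_ne_zero hC
  have hk0 : (0 : ℝ) < k := by exact_mod_cast Nat.pos_of_ne_zero hk
  set x := L / k with hx
  have hx0 : 0 < x := by positivity
  have hxk : x * k = L := by rw [hx]; field_simp
  set q := exp (-x) with hq
  have hq1 : q < 1 := by rw [hq, exp_lt_one_iff]; linarith
  have hq0 : 0 < q := exp_pos _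
  set p : unitInterval := ⟨1 - q, by constructor <;> linarith⟩ with hp
  have hpv : (p : ℝ) = 1 - q := rfl
  have hqp : 1 - (p : ℝ) = q := by rw [hpv]; ring
  have hqk : q ^ k = exp (-L) := by
    rw [hq, ← exp_nat_mul]; congr 1; rw [← hxk]; ring
  -- the ratio of the geometric series is `1 - d`; with this `d`, replacing `1 - z * (1 - d)` by
  -- `1 - z` in the `k`-th power costs only a factor `exp 1`
  set d := L / (L + k) with hd
  have hd0 : 0 < d := by positivity
  have hd1 : d < 1 := by rw [hd, div_lt_one (by positivity)]; linarith
  have h1 := connectedCount_mul_le hk p hm (t := 1 - d) (by linarith) (by linarith)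
  rw [hqp, hqk, sub_sub_cancel] at h1
  set z := exp (-L) with hz
  have hz1 : z < 1 := by rw [hz, exp_lt_one_iff]; linarith
  have hz0 : 0 < z := exp_pos _
  -- `z / (1 - z) ≤ 1 / L`
  have h2 : z * L ≤ 1 - z := by
    have a := add_one_le_exp L
    have b : z * exp L = 1 := by rw [hz, ← exp_add]; simp
    nlinarith
  have h3 : (1 - z * (1 - d)) ^ k ≤ (1 - z) ^ k * exp 1 := by
    have e1 : 1 - z * (1 - d) ≤ (1 - z) * exp (d / L) := by
      have a := add_one_le_exp (d / L)
      have b : z * d ≤ (1 - z) * (d / L) := by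
        rw [← mul_div_assoc (1 - z), le_div_iff₀ hL]
        nlinarith
      nlinarith
    have e2 : 0 ≤ 1 - z * (1 - d) := by nlinarith
    refine (pow_le_pow_left₀ e2 e1 k).trans ?_
    rw [mul_pow, ← exp_nat_mul]
    have e3 : k * (d / L) ≤ 1 := by
      rw [hd, div_div, mul_div_assoc', div_le_one (by positivity)]
      nlinarith
    have e4 : 0 ≤ (1 - z) ^ k := pow_nonneg (by linarith) k
    exact mul_le_mul_of_nonneg_left (exp_le_exp.2 e3) e4
  have h4 : (1 - z) ^ k ≤ L ^ k * exp (k * (-L / 2)) * exp (k * L ^ 2 / 24) := by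
    refine (pow_le_pow_left₀ (by linarith) (one_sub_exp_neg_le hL.le) k).trans (le_of_eq ?_)
    rw [mul_pow, mul_pow, ← exp_nat_mul, ← exp_nat_mul, mul_div_assoc]
  have h5 : (x * exp (-x / 2)) ^ (k + l) ≤ (p : ℝ) ^ (k + l) :=
    pow_le_pow_left₀ (by positivity) (by rw [hpv]; exact le_one_sub_exp_neg hx0.le) _
  set C := (connectedCount k ((k + l : ℕ) : ℤ) : ℝ) with hC'
  have h6 : C * (x * exp (-x / 2)) ^ (k + l) * q ^ (k.choose 2 - (k + l)) * d ≤
      L ^ k * exp (k * (-L / 2)) * exp (k * L ^ 2 / 24) * exp 1 := by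
    refine le_trans ?_ (h1.trans (h3.trans (mul_le_mul_of_nonneg_right h4 (exp_pos _).le)))
    gcongr
  have h7 : exp (k * (-L / 2)) ≤ exp (-x / 2) ^ (k + l) * q ^ (k.choose 2 - (k + l)) := by
    rw [hq, ← exp_nat_mul, ← exp_nat_mul, ← exp_add, exp_le_exp, Nat.cast_sub hm,
      Nat.cast_choose_two, ← hxk]
    push_cast
    have : 0 ≤ x * (l : ℝ) := by positivity
    have : 0 ≤ x * (k : ℝ) := by positivity
    nlinarith
  have h8 : C * x ^ (k + l) * d ≤ L ^ k * exp (k * L ^ 2 / 24) * exp 1 := by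
    refine le_of_mul_le_mul_right ?_ (exp_pos (k * (-L / 2)))
    calc C * x ^ (k + l) * d * exp (k * (-L / 2))
        ≤ C * x ^ (k + l) * d * (exp (-x / 2) ^ (k + l) * q ^ (k.choose 2 - (k + l))) := by
          gcongr
      _ = C * (x * exp (-x / 2)) ^ (k + l) * q ^ (k.choose 2 - (k + l)) * d := by
          rw [mul_pow]; ring
      _ ≤ _ := h6
      _ = _ := by ring
  have h9 : C * (x ^ (k + l) * d) ≤ L ^ k * exp (k * L ^ 2 / 24) * exp 1 := by
    rwa [← mul_assoc]
  rw [← le_div_iff₀ (by positivity)] at h9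
  refine h9.trans (le_of_eq ?_)
  rw [hd, hx, div_pow, pow_add L]
  field_simp

lemma cube_le_two_pow (l : ℕ) : (l : ℝ) ^ 3 ≤ 8 * 2 ^ l := by
  have h : l ^ 3 ≤ 8 * 2 ^ l := by
    rcases Nat.lt_or_ge l 4 with h | h
    · interval_cases l <;> norm_num
    · induction l, h using Nat.le_induction with
      | base => norm_num
      | succ l hl ih =>
        rw [pow_succ 2 l]
        nlinarith [mul_le_mul hl hl (by norm_num) (by omega)]
  exact_mod_cast h

/-- The bound on the number of connected graphs for large excess. The optimal `L` is
`√(12 l / k)`, and `e / 12 < 1` pays for all powers of `k`. -/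
lemma connectedCount_le_of_large {k l : ℕ} (hk : k ≠ 0) (h : k < 84 * l) :
    (connectedCount k ((k + l : ℕ) : ℤ) : ℝ) ≤
      (48 * 84 ^ 3) * ((k : ℝ) ^ k / √k * √k ^ (3 * l) / √((l : ℝ) ^ l)) := by
  have hk0 : (0 : ℝ) < k := by exact_mod_cast Nat.pos_of_ne_zero hk
  have hk1 : (1 : ℝ) ≤ k := by exact_mod_cast Nat.pos_of_ne_zero hk
  have hl0 : (0 : ℝ) < l := by exact_mod_cast (by omega)
  have hl1 : (1 : ℝ) ≤ l := by exact_mod_cast (by omega)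
  set r := √(k : ℝ) with hr
  have hr0 : 0 < r := sqrt_pos.2 hk0
  have hr1 : 1 ≤ r := one_le_sqrt.2 hk1
  have hr2 : r ^ 2 = k := sq_sqrt hk0.le
  set s := √(l : ℝ) with hs
  have hs0 : 0 < s := sqrt_pos.2 hl0
  have hs1 : 1 ≤ s := one_le_sqrt.2 hl1
  have hs2 : s ^ 2 = l := sq_sqrt hl0.le
  have hsl : √((l : ℝ) ^ l) = s ^ l := by
    rw [sqrt_eq_iff_eq_sq (by positivity) (by positivity), ← pow_mul, mul_comm, pow_mul, hs2]
  set w := √(12 : ℝ) with hw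
  have hw0 : 0 < w := by positivity
  have hw1 : 1 ≤ w := one_le_sqrt.2 (by norm_num)
  have hw2 : w ^ 2 = 12 := sq_sqrt (by norm_num)
  have h1 := connectedCount_le_exp (l := l) hk (L := w * s / r) (by positivity)
  have e1 : exp (k * (w * s / r) ^ 2 / 24) = √(exp 1) ^ l := by
    have : k * (w * s / r) ^ 2 / 24 = l * (1 / 2) := by
      rw [div_pow, mul_pow, hw2, hs2, hr2]; field_simp; norm_num
    rw [this, exp_nat_mul, exp_half]
  have e2 : √(exp 1) / w ≤ 1 / 2 := by
    rw [div_le_iff₀ hw0, sqrt_le_left (by positivity), mul_pow, hw2]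
    linarith [exp_one_lt_three]
  have e3 : 1 + k / (w * s / r) ≤ 2 * r ^ 3 := by
    have : k / (w * s / r) ≤ r ^ 3 := by
      rw [← hr2, div_div_eq_mul_div, div_le_iff₀ (by positivity)]
      have : 1 ≤ w * s := one_le_mul_of_one_le_of_one_le hw1 hs1
      nlinarith [pow_pos hr0 3]
    have : 1 ≤ r ^ 3 := one_le_pow₀ hr1
    linarith
  rw [e1] at h1
  rw [hsl]
  have e4 : ((k : ℝ) ^ (k + l) / (w * s / r) ^ l) * √(exp 1) ^ l =
      (k : ℝ) ^ k * r ^ (3 * l) / s ^ l * (√(exp 1) / w) ^ l := by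
    rw [pow_add, ← hr2, div_pow, mul_pow, div_pow, show 3 * l = 2 * l + l by ring, pow_add,
      pow_mul r 2 l]
    field_simp
  have e5 : (√(exp 1) / w) ^ l ≤ (1 / 2) ^ l := by gcongr
  have e6 : r ^ 4 * (1 / 2) ^ l ≤ 8 * 84 ^ 3 := by
    have a : r ^ 4 = (k : ℝ) ^ 2 := by rw [← hr2]; ring
    have b : (k : ℝ) ^ 2 ≤ (k : ℝ) ^ 3 := pow_le_pow_right₀ hk1 (by norm_num)
    have c : (k : ℝ) ≤ 84 * l := by exact_mod_cast h.le
    have d : (k : ℝ) ^ 3 ≤ (84 * l) ^ 3 := by gcongr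
    have e := cube_le_two_pow l
    rw [one_div, inv_pow, ← div_eq_mul_inv, div_le_iff₀ (by positivity), a]
    rw [mul_pow] at d
    linarith
  calc _ ≤ _ := h1
    _ = exp 1 * (1 + k / (w * s / r)) *
        (((k : ℝ) ^ (k + l) / (w * s / r) ^ l) * √(exp 1) ^ l) := by ring
    _ ≤ 3 * (2 * r ^ 3) * ((k : ℝ) ^ k * r ^ (3 * l) / s ^ l * (1 / 2) ^ l) := by
        rw [e4]
        gcongr
        exact exp_one_lt_three.le
    _ = 6 * (r ^ 4 * (1 / 2) ^ l) * ((k : ℝ) ^ k / r * r ^ (3 * l) / s ^ l) := by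
        field_simp
        norm_num
    _ ≤ 6 * (8 * 84 ^ 3) * ((k : ℝ) ^ k / r * r ^ (3 * l) / s ^ l) := by
        gcongr
    _ = _ := by ring

/-- The uniform bound on the number of connected graphs with `k` vertices and `k + l` edges. -/
lemma connectedCount_le {k : ℕ} (l : ℕ) (hk : k ≠ 0) :
    (connectedCount k ((k + l : ℕ) : ℤ) : ℝ) ≤
      (48 * 84 ^ 3) * ((k : ℝ) ^ k / √k * √k ^ (3 * l) / √((l : ℝ) ^ l)) := by
  rcases Nat.lt_or_ge k (84 * l) with h | h
  · exact connectedCount_le_of_large hk h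
  · refine (connectedCount_le_of_small hk h).trans ?_
    gcongr
    norm_num

end LargeExcess

/-! ### The near-critical scaling -/

section Scaling

open Real
open scoped Nat

/-- The relative deviation `e` of the edge probability from `1 / n`, that is,
`p = (1 + e) / n`. -/
noncomputable def deviation (n : ℕ) (lam : ℝ) : ℝ := lam * (n : ℝ) ^ (-(1 / 3) : ℝ)

lemma deviation_eq_div (n : ℕ) (lam : ℝ) : deviation n lam = lam / (n : ℝ) ^ (1 / 3 : ℝ) := by
  rw [deviation, rpow_neg (Nat.cast_nonneg n), ← div_eq_mul_inv]

lemma cubeRoot_pow (n : ℕ) : ((n : ℝ) ^ (1 / 3 : ℝ)) ^ 3 = n := by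
  rw [← rpow_natCast, ← rpow_mul (Nat.cast_nonneg n)]
  norm_num

lemma edgeProb_eq {n : ℕ} (hn : n ≠ 0) (lam : ℝ) :
    edgeProb n lam = (1 + deviation n lam) / n := by
  have hn0 : (0 : ℝ) < n := by exact_mod_cast Nat.pos_of_ne_zero hn
  rw [edgeProb, deviation, show (-(4 / 3) : ℝ) = -1 + -(1 / 3) by norm_num, rpow_add hn0,
    rpow_neg_one]
  field_simp

lemma F_eq {n : ℕ} (hn : n ≠ 0) (k : ℕ) (lam : ℝ) :
    F lam (k / (n : ℝ) ^ (2 / 3 : ℝ)) = (k : ℝ) ^ 3 / (6 * (n : ℝ) ^ 2) -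
      deviation n lam * (k : ℝ) ^ 2 / (2 * n) + deviation n lam ^ 2 * k / 2 := by
  have hn0 : (0 : ℝ) < n := by exact_mod_cast Nat.pos_of_ne_zero hn
  rw [F, deviation_eq_div, show (n : ℝ) ^ (2 / 3 : ℝ) = ((n : ℝ) ^ (1 / 3 : ℝ)) ^ 2 by
    rw [← rpow_natCast, ← rpow_mul (Nat.cast_nonneg n)]; norm_num]
  have hb := cubeRoot_pow n
  have hb0 : 0 < (n : ℝ) ^ (1 / 3 : ℝ) := rpow_pos_of_pos hn0 _
  set b := (n : ℝ) ^ (1 / 3 : ℝ) with hbdef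
  clear_value b
  rw [← hb]
  field_simp

lemma deviation_pow_three (n : ℕ) (lam : ℝ) : deviation n lam ^ 3 = lam ^ 3 / n := by
  rw [deviation_eq_div, div_pow, cubeRoot_pow]

lemma fourthRoot_pow (n : ℕ) : ((n : ℝ) ^ (1 / 4 : ℝ)) ^ 4 = n := by
  rw [← rpow_natCast, ← rpow_mul (Nat.cast_nonneg n)]
  norm_num

lemma one_le_fourthRoot {n : ℕ} (hn : n ≠ 0) : 1 ≤ (n : ℝ) ^ (1 / 4 : ℝ) :=
  one_le_rpow (by exact_mod_cast Nat.one_le_iff_ne_zero.2 hn) (by norm_num)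

/-- The bound `2 ^ (-1/4) ≤ 17 / 20`, which keeps the arguments of all logarithms away from `0`. -/
lemma inv_fourthRoot_le {n : ℕ} (hn : 2 ≤ n) : 1 / (n : ℝ) ^ (1 / 4 : ℝ) ≤ 17 / 20 := by
  have h := fourthRoot_pow n
  have h1 := one_le_fourthRoot (n := n) (by omega)
  set g := (n : ℝ) ^ (1 / 4 : ℝ)
  have h2 : (2 : ℝ) ≤ n := by exact_mod_cast hn
  rw [div_le_iff₀ (by linarith)]
  by_contra hlt
  push Not at hlt
  have h3 : g < 20 / 17 := by linarith
  have h4 : g ^ 4 < (20 / 17) ^ 4 := by gcongr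
  norm_num at h4
  linarith

lemma abs_deviation_le {n : ℕ} (hn : n ≠ 0) {lam : ℝ} (h : |lam| ≤ (n : ℝ) ^ (1 / 12 : ℝ)) :
    |deviation n lam| ≤ 1 / (n : ℝ) ^ (1 / 4 : ℝ) := by
  have hn0 : (0 : ℝ) < n := by exact_mod_cast Nat.pos_of_ne_zero hn
  rw [deviation, abs_mul, abs_of_pos (rpow_pos_of_pos hn0 _), one_div ((n : ℝ) ^ _),
    ← rpow_neg hn0.le]
  calc _ ≤ (n : ℝ) ^ (1 / 12 : ℝ) * (n : ℝ) ^ (-(1 / 3) : ℝ) := by gcongr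
    _ = _ := by rw [← rpow_add hn0]; norm_num

end Scaling

/-! ### The factors of the first moment -/

section FirstMoment

open Real
open scoped Nat

lemma sum_range_cast (k : ℕ) : ∑ j ∈ Finset.range k, (j : ℝ) = k * (k - 1) / 2 := by
  induction k with
  | zero => simp
  | succ k ih => rw [Finset.sum_range_succ, ih]; push_cast; ring

lemma sum_range_cast_sq (k : ℕ) :
    ∑ j ∈ Finset.range k, (j : ℝ) ^ 2 = k * (k - 1) * (2 * k - 1) / 6 := by
  induction k with
  | zero => simp
  | succ k ih => rw [Finset.sum_range_succ, ih]; push_cast; ring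

lemma cast_choose_eq_prod {n k : ℕ} (hn : n ≠ 0) (hk : k ≤ n) :
    (n.choose k : ℝ) = (∏ j ∈ Finset.range k, (1 - (j : ℝ) / n)) * (n : ℝ) ^ k / k ! := by
  have hn0 : (0 : ℝ) < n := by exact_mod_cast Nat.pos_of_ne_zero hn
  rw [eq_div_iff (by positivity), mul_comm, ← Nat.cast_mul,
    ← Nat.descFactorial_eq_factorial_mul_choose, Nat.descFactorial_eq_prod_range, Nat.cast_prod]
  rw [← Finset.card_range k, ← Finset.prod_const, Finset.card_range, ← Finset.prod_mul_distrib]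
  refine Finset.prod_congr rfl fun j hj => ?_
  have := Finset.mem_range.1 hj
  rw [Nat.cast_sub (by omega)]
  field_simp

/-- The number of pairs of vertices that meet a given set of `k` vertices, minus `m`. -/
lemma cast_pairs {n k m : ℕ} (hk : k ≤ n) (hm : m ≤ k.choose 2) :
    ((k.choose 2 + k * (n - k) - m : ℕ) : ℝ) = k * n - (k : ℝ) ^ 2 / 2 - k / 2 - m := by
  rw [Nat.cast_sub (by omega), Nat.cast_add, Nat.cast_mul, Nat.cast_sub hk, Nat.cast_choose_two]
  ring

lemma one_sub_le_exp {x : ℝ} (hx0 : 0 ≤ x) (hx1 : x < 1) :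
    1 - x ≤ exp (-(x + x ^ 2 / 2)) := by
  have h := hasSum_pow_div_log_of_abs_lt_one (x := x) (by rwa [abs_of_nonneg hx0])
  have h1 := sum_le_hasSum (Finset.range 2) (fun i _ => by positivity) h
  simp only [Finset.sum_range_succ, Finset.sum_range_zero] at h1
  norm_num at h1
  rw [← log_le_iff_le_exp (by linarith)]
  linarith

/-- The source of the term `lam ^ 3 * k / (3 * n)` in the upper bound. -/
lemma one_add_le_exp_cubic {x : ℝ} (hx : -1 < x) :
    1 + x ≤ exp (x - x ^ 2 / 2 + x ^ 3 / 3) := by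
  rw [← log_le_iff_le_exp (by linarith)]
  rcases le_total 0 x with h0 | h0
  · have hd : ∀ y ∈ Set.Ici (0 : ℝ), HasDerivAt
        (fun y => y - y ^ 2 / 2 + y ^ 3 / 3 - log (1 + y)) (y ^ 3 / (1 + y)) y := by
      intro y hy
      have hy : 0 ≤ y := hy
      have h1 : HasDerivAt (fun y : ℝ => y - y ^ 2 / 2 + y ^ 3 / 3 - log (1 + y))
          (1 - (2 : ℕ) * y ^ (2 - 1) / 2 + (3 : ℕ) * y ^ (3 - 1) / 3 - 1 / (1 + y)) y :=
        (((hasDerivAt_id y).sub ((hasDerivAt_pow 2 y).div_const 2)).add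
          ((hasDerivAt_pow 3 y).div_const 3)).sub
          (((hasDerivAt_id y).const_add 1).log (by simp; linarith))
      convert h1 using 1
      field_simp
      norm_num
      ring
    have hm : MonotoneOn (fun y : ℝ => y - y ^ 2 / 2 + y ^ 3 / 3 - log (1 + y)) (Set.Ici 0) := by
      refine monotoneOn_of_deriv_nonneg (convex_Ici 0)
        (fun y hy => (hd y hy).continuousAt.continuousWithinAt)
        (fun y hy => (hd y (interior_subset hy)).differentiableAt.differentiableWithinAt) ?_
      intro y hy
      have hy0 : (0 : ℝ) ≤ y := interior_subset hy
      rw [(hd y hy0).deriv]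
      positivity
    have := hm (Set.mem_Ici.2 le_rfl) (Set.mem_Ici.2 h0) h0
    norm_num at this
    linarith
  · have h := hasSum_pow_div_log_of_abs_lt_one (x := -x) (by rw [abs_of_nonneg] <;> linarith)
    have h1 := sum_le_hasSum (Finset.range 3)
      (fun i _ => div_nonneg (pow_nonneg (by linarith) _) (by positivity)) h
    simp only [Finset.sum_range_succ, Finset.sum_range_zero] at h1
    norm_num at h1
    have e : (-x) ^ 3 = -x ^ 3 := by ring
    rw [e] at h1
    linarith

/-- The factors of the first moment that do not depend on the number of edges, up to a constant
factor. -/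
lemma choose_mul_pow_le {n k : ℕ} (hn : 3 ≤ n) (hk : 1 ≤ k) (hkn : k + 1 ≤ n) {e : ℝ}
    (he : |e| ≤ 17 / 20) (hp : (1 + e) / n ≤ 1) :
    (n.choose k : ℝ) * ((1 + e) / n) ^ k *
      (1 - (1 + e) / n) ^ (k.choose 2 + k * (n - k) - k) ≤
    exp 4 * ((1 / √k) / (k : ℝ) ^ k) * exp (-((k : ℝ) ^ 3 / (6 * (n : ℝ) ^ 2) -
      e * (k : ℝ) ^ 2 / (2 * n) + e ^ 2 * k / 2) + 1 / 3 * e ^ 3 * k) := by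
  have hn0 : (0 : ℝ) < n := by exact_mod_cast (by omega)
  have hk0 : (0 : ℝ) < k := by exact_mod_cast hk
  have hkn' : (k : ℝ) ≤ n := by exact_mod_cast (by omega)
  obtain ⟨he1, he2⟩ := abs_le.1 he
  have hp0 : 0 ≤ (1 + e) / n := div_nonneg (by linarith) hn0.le
  -- the falling factorial
  have h1 : ∏ j ∈ Finset.range k, (1 - (j : ℝ) / n) ≤
      exp (-((k * (k - 1) / 2) / n + (k * (k - 1) * (2 * k - 1) / 6) / n ^ 2 / 2)) := by
    rw [← sum_range_cast, ← sum_range_cast_sq, Finset.sum_div, Finset.sum_div, Finset.sum_div,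
      ← Finset.sum_add_distrib, ← Finset.sum_neg_distrib, exp_sum]
    refine Finset.prod_le_prod (fun j hj => ?_) (fun j hj => ?_)
    all_goals
      have hj : (j : ℝ) < n := by
        have := Finset.mem_range.1 hj
        exact_mod_cast (by omega)
      have hj1 : (j : ℝ) / n < 1 := by rwa [div_lt_one hn0]
    · linarith
    · rw [← div_pow]
      exact one_sub_le_exp (by positivity) hj1
  have h2 : (1 + e) ^ k ≤ exp (k * (e - e ^ 2 / 2 + e ^ 3 / 3)) := by
    rw [exp_nat_mul]
    exact pow_le_pow_left₀ (by linarith) (one_add_le_exp_cubic (by linarith)) k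
  have hM : ((k.choose 2 + k * (n - k) - k : ℕ) : ℝ) = k * n - (k : ℝ) ^ 2 / 2 - k / 2 - k := by
    have : k ≤ k * (n - k) := Nat.le_mul_of_pos_right k (by omega)
    rw [Nat.cast_sub (by omega), Nat.cast_add, Nat.cast_mul, Nat.cast_sub (by omega),
      Nat.cast_choose_two]
    ring
  have h3 : (1 - (1 + e) / n) ^ (k.choose 2 + k * (n - k) - k) ≤
      exp (-((k * n - (k : ℝ) ^ 2 / 2 - k / 2 - k) * ((1 + e) / n))) := by
    rw [← hM, ← mul_neg, exp_nat_mul]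
    refine pow_le_pow_left₀ (by linarith) ?_ _
    have := add_one_le_exp (-((1 + e) / n))
    linarith
  have h4 : 1 / (k ! : ℝ) ≤ exp k * ((1 / √k) / (k : ℝ) ^ k) := by
    have := pow_self_div_factorial_le (n := k) (by omega)
    rw [div_le_div_iff₀ (by positivity) (by positivity)] at this
    rw [div_div, mul_one_div, div_le_div_iff₀ (by positivity) (by positivity)]
    linarith
  rw [cast_choose_eq_prod (by omega) (by omega), div_pow]
  calc _ = (∏ j ∈ Finset.range k, (1 - (j : ℝ) / n)) * (1 + e) ^ k *
        (1 - (1 + e) / n) ^ (k.choose 2 + k * (n - k) - k) * (1 / (k ! : ℝ)) := by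
        field_simp
    _ ≤ exp (-((k * (k - 1) / 2) / n + (k * (k - 1) * (2 * k - 1) / 6) / n ^ 2 / 2)) *
        exp (k * (e - e ^ 2 / 2 + e ^ 3 / 3)) *
        exp (-((k * n - (k : ℝ) ^ 2 / 2 - k / 2 - k) * ((1 + e) / n))) *
        (exp k * ((1 / √k) / (k : ℝ) ^ k)) := by
        gcongr
        exact pow_nonneg (by linarith) _
    _ = exp ((k : ℝ) / (2 * n) + (k : ℝ) ^ 2 / (4 * n ^ 2) - k / (12 * n ^ 2) +
          3 / 2 * (1 + e) * (k / n)) * ((1 / √k) / (k : ℝ) ^ k) *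
          exp (-((k : ℝ) ^ 3 / (6 * (n : ℝ) ^ 2) -
          e * (k : ℝ) ^ 2 / (2 * n) + e ^ 2 * k / 2) + 1 / 3 * e ^ 3 * k) := by
        rw [mul_right_comm (exp _) ((1 / √(k : ℝ)) / (k : ℝ) ^ k), ← mul_assoc, ← exp_add,
          ← exp_add, ← exp_add, ← exp_add]
        congr 2
        field_simp
        ring
    _ ≤ _ := by
        gcongr
        have a1 : (k : ℝ) / n ≤ 1 := by rwa [div_le_one hn0]
        have a0 : 0 ≤ (k : ℝ) / n := by positivity
        have a2 : (k : ℝ) / (2 * n) = 1 / 2 * (k / n) := by field_simp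
        have a3 : (k : ℝ) ^ 2 / (4 * n ^ 2) = 1 / 4 * (k / n) ^ 2 := by field_simp
        have a4 : 0 ≤ (k : ℝ) / (12 * n ^ 2) := by positivity
        rw [a2, a3]
        nlinarith

end FirstMoment

/-! ### The upper bound on the first moment -/

section UpperBound

open Real
open scoped Nat

lemma upperTerm_nonneg {n k : ℕ} {l : ℤ} {lam : ℝ} (hn : 3 ≤ n)
    (he : |deviation n lam| ≤ 17 / 20) : 0 ≤ upperTerm k n l lam := by
  have hn0 : (3 : ℝ) ≤ n := by exact_mod_cast hn
  have h1 : 0 ≤ 1 + lam * (n : ℝ) ^ (-(1 / 3) : ℝ) := by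
    have := (abs_le.1 he).1
    rw [deviation] at this
    linarith
  have h2 : 0 ≤ 1 - 2 * (n : ℝ)⁻¹ := by
    have : (n : ℝ)⁻¹ ≤ 3⁻¹ := by gcongr
    linarith
  have h3 : 0 ≤ max (l : ℝ) 1 := le_max_of_le_right zero_le_one
  rw [upperTerm]
  have h4 : 0 ≤ (k : ℝ) ^ 3 / ((n : ℝ) ^ 2 * max (l : ℝ) 1) := by positivity
  positivity

/-- The first moment bound for all excesses. -/
lemma expectedCount_le {n k : ℕ} {l : ℤ} {lam : ℝ} {p : unitInterval}
    (hp : (p : ℝ) = edgeProb n lam) (hlam : |lam| ≤ (n : ℝ) ^ (1 / 12 : ℝ)) (hn : 3 ≤ n)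
    (hk : 1 ≤ k) (hkn : k + 1 ≤ n) (hl : -1 ≤ l) :
    expectedCount n p k (k + l) ≤ (48 * 84 ^ 3 * exp 4) * upperTerm k n l lam := by
  have hn0 : (3 : ℝ) ≤ n := by exact_mod_cast hn
  have hk0 : (0 : ℝ) < k := by exact_mod_cast hk
  have he : |deviation n lam| ≤ 17 / 20 :=
    (abs_deviation_le (by omega) hlam).trans (inv_fourthRoot_le (by omega))
  obtain ⟨m, hm⟩ : ∃ m : ℕ, (k : ℤ) + l = m := ⟨(k + l).toNat, by omega⟩
  rw [hm, expectedCount_eq]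
  by_cases hC : connectedCount k m = 0
  · rw [hC]
    simp only [Nat.cast_zero, mul_zero, zero_mul]
    have := upperTerm_nonneg (k := k) (l := l) hn he
    positivity
  have hmc := le_choose_two_of_connectedCount_ne_zero hC
  rw [edgeProb_eq (by omega)] at hp
  have hmain := choose_mul_pow_le hn hk hkn he (hp ▸ p.2.2)
  have hdev3 : 1 / 3 * lam ^ 3 * k * (n : ℝ)⁻¹ = 1 / 3 * deviation n lam ^ 3 * k := by
    rw [deviation_pow_three]; ring
  rw [upperTerm, hdev3, F_eq (by omega), ← deviation, hp]
  set e := deviation n lam with hedef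
  obtain ⟨he1, he2⟩ := abs_le.1 he
  set E := exp (-((k : ℝ) ^ 3 / (6 * (n : ℝ) ^ 2) - e * (k : ℝ) ^ 2 / (2 * n) + e ^ 2 * k / 2) +
    1 / 3 * e ^ 3 * k) with hE
  have hE0 : 0 < E := exp_pos _
  set q := 1 - (1 + e) / n with hq
  have hninv : 1 - 2 * (n : ℝ)⁻¹ = (n - 2) / n := by field_simp
  have hq0 : (n - 2 : ℝ) / n ≤ q := by
    rw [hq, sub_div, div_self (by positivity)]
    have : (1 + e) / n ≤ 2 / n := by gcongr; linarith
    linarith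
  have hn2 : (0 : ℝ) < (n - 2) / n := div_pos (by linarith) (by linarith)
  have hqpos : 0 < q := hn2.trans_le hq0
  have hq1 : q ≤ 1 := by
    have : 0 ≤ (1 + e) / n := div_nonneg (by linarith) (by linarith)
    linarith
  have hkk : k ≤ k * (n - k) := Nat.le_mul_of_pos_right k (by omega)
  rw [hninv]
  have h1e : 0 < 1 + e := by linarith
  have hnpos : (0 : ℝ) < n := by linarith
  set r := √(k : ℝ) with hr
  have hr0 : 0 < r := sqrt_pos.2 hk0
  have hr2 : r ^ 2 = k := sq_sqrt hk0.le
  set A := (n.choose k : ℝ) * ((1 + e) / n) ^ k * q ^ (k.choose 2 + k * (n - k) - k) with hA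
  have hA0 : 0 ≤ A := by positivity
  set c : ℝ := 48 * 84 ^ 3 with hc
  have hc1 : 3 ≤ c := by rw [hc]; norm_num
  -- `l ≥ 0`, and the case `l = -1` of trees after it
  rcases l with l | l
  · obtain rfl : m = k + l := by
      have : (Int.ofNat l) = (l : ℤ) := rfl
      omega
    have hcore := connectedCount_le l (k := k) (by omega)
    rw [← hc, ← hr] at hcore
    have e1 : q ^ (k.choose 2 + k * (n - k) - k) =
        q ^ (k.choose 2 + k * (n - k) - (k + l)) * q ^ l := by
      rw [← pow_add]; congr 1; omega
    have e2 : ((k : ℝ) ^ 3 / ((n : ℝ) ^ 2 * max ((Int.ofNat l : ℤ) : ℝ) 1)) ^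
        (((Int.ofNat l : ℤ) : ℝ) / 2) = r ^ (3 * l) / √((l : ℝ) ^ l) / (n : ℝ) ^ l := by
      have e3 : ((Int.ofNat l : ℤ) : ℝ) = l := by simp
      rw [e3, show (l : ℝ) / 2 = 1 / 2 * l by ring, rpow_mul (by positivity), ← sqrt_eq_rpow,
        rpow_natCast, sqrt_div (by positivity), sqrt_mul (by positivity), sqrt_sq hnpos.le]
      have e4 : √((k : ℝ) ^ 3) = r ^ 3 := by
        rw [sqrt_eq_iff_eq_sq (by positivity) (by positivity), ← hr2]; ring
      have e5 : √(max (l : ℝ) 1) ^ l = √((l : ℝ) ^ l) := by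
        rcases Nat.eq_zero_or_pos l with rfl | hl0
        · simp
        · have : (1 : ℝ) ≤ l := by exact_mod_cast hl0
          rw [max_eq_left this, eq_comm, sqrt_eq_iff_eq_sq (by positivity) (by positivity),
            ← pow_mul, mul_comm, pow_mul, sq_sqrt (by positivity)]
      rw [e4, div_pow, mul_pow, e5, ← pow_mul]
      field_simp
    rw [e2, Int.ofNat_eq_natCast, zpow_natCast]
    have hsl : 0 < √((l : ℝ) ^ l) := by
      rcases Nat.eq_zero_or_pos l with rfl | hl
      · simp
      · exact sqrt_pos.2 (by positivity)
    calc _ = A * connectedCount k ((k + l : ℕ) : ℤ) * (((1 + e) / q) ^ l / (n : ℝ) ^ l) := by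
          rw [hA, e1, pow_add, div_pow (1 + e) q l, div_pow (1 + e) (n : ℝ) l]
          field_simp
      _ ≤ (exp 4 * ((1 / r) / (k : ℝ) ^ k) * E) *
          (c * ((k : ℝ) ^ k / r * r ^ (3 * l) / √((l : ℝ) ^ l))) *
          (((1 + e) / ((n - 2) / n)) ^ l / (n : ℝ) ^ l) := by gcongr
      _ = _ := by
          rw [← hr2]
          field_simp
  · obtain rfl : l = 0 := by
      have : Int.negSucc l = -(l : ℤ) - 1 := by rw [Int.negSucc_eq]; ring
      omega
    obtain ⟨i, rfl⟩ := Nat.exists_eq_succ_of_ne_zero (show k ≠ 0 by omega)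
    have hm' : m = i := by
      have : Int.negSucc 0 = -1 := rfl
      rw [this] at hm
      push_cast at hm
      omega
    subst hm'
    set k := m.succ with hkdef
    have hcore := connectedCount_tree_le (k := k) (by omega)
    have e0 : (k : ℤ) + -1 = m := hm
    rw [e0] at hcore
    have e1 : q ^ (k.choose 2 + k * (n - k) - m) =
        q ^ (k.choose 2 + k * (n - k) - k) * q := by
      rw [← pow_succ]; congr 1; omega
    have e3 : ((Int.negSucc 0 : ℤ) : ℝ) = -1 := by simp
    have e2 : ((k : ℝ) ^ 3 / ((n : ℝ) ^ 2 * max ((Int.negSucc 0 : ℤ) : ℝ) 1)) ^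
        (((Int.negSucc 0 : ℤ) : ℝ) / 2) = n / r ^ 3 := by
      have e4 : √((k : ℝ) ^ 3) = r ^ 3 := by
        rw [sqrt_eq_iff_eq_sq (by positivity) (by positivity), ← hr2]; ring
      rw [e3, max_eq_right (by norm_num), mul_one, show (-1 : ℝ) / 2 = -(1 / 2) by norm_num,
        rpow_neg (by positivity), ← sqrt_eq_rpow, sqrt_div (by positivity), sqrt_sq hnpos.le, e4,
        inv_div]
    have e5 : ((1 + e) / ((n - 2) / n)) ^ (Int.negSucc 0) = ((n - 2) / n) / (1 + e) := by
      rw [zpow_negSucc]; simp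
    rw [e2, e5]
    have e6 : ((1 + e) / n) ^ m * ((1 + e) / n) = ((1 + e) / n) ^ k := by
      rw [hkdef, Nat.succ_eq_add_one, pow_succ]
    -- the factor `(1 - 2 / n) ^ l` of the bound is now in the numerator; it is at least `1 / 3`
    have hq3 : q ≤ 3 * ((n - 2) / n) := by
      refine hq1.trans ?_
      rw [mul_div_assoc', le_div_iff₀ hnpos]
      linarith
    calc _ = A * connectedCount k m * (q * n / (1 + e)) := by
          rw [hA, e1, ← e6]
          field_simp
      _ ≤ (exp 4 * ((1 / r) / (k : ℝ) ^ k) * E) * ((k : ℝ) ^ k / (k : ℝ) ^ 2) *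
          ((3 * ((n - 2) / n)) * n / (1 + e)) := by gcongr
      _ = 3 * (exp 4 * (1 / k * (n / r ^ 3) * E * (((n - 2) / n) / (1 + e)))) := by
          rw [← hr2]
          field_simp
      _ ≤ c * (exp 4 * (1 / k * (n / r ^ 3) * E * (((n - 2) / n) / (1 + e)))) := by gcongr
      _ = _ := by ring

end UpperBound

/-! ### Logarithmic estimates -/

section LogEstimates

open Real Filter Topology
open scoped Nat

/-- Robbins' upper bound: `log (stirlingSeq n) - 1 / (12 n)` increases to `log √π`. -/
lemma log_stirlingSeq_le {n : ℕ} (hn : n ≠ 0) :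
    log (Stirling.stirlingSeq n) ≤ log (√π) + 1 / (12 * n) := by
  obtain ⟨j, rfl⟩ := Nat.exists_eq_succ_of_ne_zero hn
  have hmono : Monotone fun i : ℕ =>
      log (Stirling.stirlingSeq (i + 1)) - 1 / (12 * ((i : ℝ) + 1)) := by
    refine monotone_nat_of_le_succ fun i => ?_
    have h := Stirling.log_stirlingSeq_sdiff_le (i + 1)
    have e : 1 / (12 * ((i : ℝ) + 1)) - 1 / (12 * (((i + 1 : ℕ) : ℝ) + 1)) =
        1 / (12 * ((i : ℝ) + 1) * ((i : ℝ) + 1 + 1)) := by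
      push_cast
      field_simp
      ring
    push_cast at *
    linarith
  have hlim : Tendsto (fun i : ℕ =>
      log (Stirling.stirlingSeq (i + 1)) - 1 / (12 * ((i : ℝ) + 1))) atTop (𝓝 (log √π - 0)) := by
    refine Tendsto.sub ?_ ?_
    · exact ((continuousAt_log (by positivity)).tendsto.comp
        Stirling.tendsto_stirlingSeq_sqrt_pi).comp (tendsto_add_atTop_nat 1)
    · have := tendsto_one_div_add_atTop_nhds_zero_nat (𝕜 := ℝ)
      have := this.const_mul (1 / 12)
      rw [mul_zero] at this
      refine this.congr fun i => ?_
      field_simp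
  have h := hmono.ge_of_tendsto hlim j
  simp only [sub_zero, Nat.succ_eq_add_one] at h ⊢
  push_cast
  linarith

/-- Stirling's formula with a relative error of order `1 / k`. -/
lemma abs_stirling_error_le {k : ℕ} (hk : k ≠ 0) :
    |log (2 * π) / 2 + (k + 1 / 2) * log k - log k ! - k| ≤ 1 / k := by
  have hk0 : (0 : ℝ) < k := by exact_mod_cast Nat.pos_of_ne_zero hk
  have h1 := Stirling.le_log_factorial_stirling hk
  have h2 := log_stirlingSeq_le hk
  rw [Stirling.log_stirlingSeq_formula, log_sqrt pi_pos.le, log_div hk0.ne' (exp_pos 1).ne',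
    log_exp, log_mul (by norm_num) hk0.ne'] at h2
  have h3 : (1 : ℝ) / (12 * k) ≤ 1 / k := by
    apply one_div_le_one_div_of_le hk0; linarith
  have h4 : (0 : ℝ) ≤ 1 / k := by positivity
  have h5 : log (2 * π) = log 2 + log π := log_mul (by norm_num) pi_pos.ne'
  rw [abs_le]
  constructor <;> nlinarith

lemma abs_log_one_add_sub_le {x : ℝ} (hx : |x| ≤ 17 / 20) :
    |log (1 + x) - (x - x ^ 2 / 2)| ≤ 7 * |x| ^ 3 := by
  have h := abs_log_sub_add_sum_range_le (x := -x) (by rw [abs_neg]; linarith) 2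
  simp only [Finset.sum_range_succ, Finset.sum_range_zero, abs_neg, sub_neg_eq_add] at h
  norm_num at h
  have e : log (1 + x) - (x - x ^ 2 / 2) = -x + x ^ 2 / 2 + log (1 + x) := by ring
  rw [e]
  refine h.trans ?_
  rw [div_le_iff₀ (by linarith)]
  nlinarith [pow_nonneg (abs_nonneg x) 3]

lemma abs_log_one_add_le {x : ℝ} (hx : |x| ≤ 17 / 20) : |log (1 + x)| ≤ 7 * |x| := by
  have h := abs_log_sub_add_sum_range_le (x := -x) (by rw [abs_neg]; linarith) 0
  simp only [Finset.sum_range_zero, abs_neg, sub_neg_eq_add, zero_add, pow_one] at h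
  refine h.trans ?_
  rw [div_le_iff₀ (by linarith)]
  nlinarith [abs_nonneg x]

/-- The falling factorial: `j / n + j ^ 2 / (2 n ^ 2)` sums to `k ^ 2 / (2 n) + k ^ 3 / (6 n ^ 2)`
up to `k / n`. -/
lemma abs_log_prod_le {n k : ℕ} (hn : n ≠ 0) (hkn : (k : ℝ) / n ≤ 17 / 20) :
    |log (∏ j ∈ Finset.range k, (1 - (j : ℝ) / n)) + (k : ℝ) ^ 2 / (2 * n) +
      (k : ℝ) ^ 3 / (6 * (n : ℝ) ^ 2)| ≤ 7 * ((k : ℝ) ^ 4 / (n : ℝ) ^ 3) + k / n := by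
  have hn0 : (0 : ℝ) < n := by exact_mod_cast Nat.pos_of_ne_zero hn
  have hj : ∀ j ∈ Finset.range k, (j : ℝ) / n ≤ k / n := fun j hj => by
    have := (Finset.mem_range.1 hj).le
    gcongr
  rw [log_prod (fun j h => by have := hj j h; linarith)]
  have h1 : |∑ j ∈ Finset.range k, (log (1 - (j : ℝ) / n) + (j : ℝ) / n + ((j : ℝ) / n) ^ 2 / 2)| ≤
      7 * ((k : ℝ) ^ 4 / (n : ℝ) ^ 3) := by
    refine (Finset.abs_sum_le_sum_abs _ _).trans ?_
    calc _ ≤ ∑ j ∈ Finset.range k, 7 * ((k : ℝ) / n) ^ 3 := by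
          refine Finset.sum_le_sum fun j h => ?_
          have h2 := hj j h
          have h0 : (0 : ℝ) ≤ (j : ℝ) / n := by positivity
          have h3 := abs_log_one_add_sub_le (x := -((j : ℝ) / n))
            (by rw [abs_neg, abs_of_nonneg h0]; linarith)
          rw [abs_neg, abs_of_nonneg h0] at h3
          refine le_trans (le_of_eq ?_) (h3.trans ?_)
          · congr 1; rw [← sub_eq_add_neg]; ring
          · gcongr
      _ = _ := by
          rw [Finset.sum_const, Finset.card_range, nsmul_eq_mul]
          field_simp
  have h2 : ∑ j ∈ Finset.range k, (log (1 - (j : ℝ) / n) + (j : ℝ) / n + ((j : ℝ) / n) ^ 2 / 2) =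
      ∑ j ∈ Finset.range k, log (1 - (j : ℝ) / n) + (k * (k - 1) / 2) / n +
        (k * (k - 1) * (2 * k - 1) / 6) / n ^ 2 / 2 := by
    simp only [div_pow]
    rw [Finset.sum_add_distrib, Finset.sum_add_distrib, ← Finset.sum_div, ← Finset.sum_div,
      ← Finset.sum_div, sum_range_cast, sum_range_cast_sq]
  rw [h2] at h1
  set x := (k : ℝ) / n with hx
  have hx0 : 0 ≤ x := by positivity
  have e1 : ∑ j ∈ Finset.range k, log (1 - (j : ℝ) / n) + (k : ℝ) ^ 2 / (2 * n) +
      (k : ℝ) ^ 3 / (6 * (n : ℝ) ^ 2) = (∑ j ∈ Finset.range k, log (1 - (j : ℝ) / n) +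
        (k * (k - 1) / 2) / n + (k * (k - 1) * (2 * k - 1) / 6) / n ^ 2 / 2) +
        (x / 2 + x ^ 2 / 4 - x / (12 * n)) := by
    rw [hx]
    field_simp
    ring
  have hn1 : (1 : ℝ) ≤ n := by exact_mod_cast Nat.pos_of_ne_zero hn
  have h4 : x / (12 * n) ≤ x / 12 := by
    apply div_le_div_of_nonneg_left hx0 (by norm_num); linarith
  have h5 : 0 ≤ x / (12 * n) := by positivity
  have h6 : |x / 2 + x ^ 2 / 4 - x / (12 * n)| ≤ x := by
    rw [abs_le]; constructor <;> nlinarith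
  rw [e1]
  exact (abs_add_le _ _).trans (add_le_add h1 h6)

lemma abs_mul_log_one_add_le {k m : ℕ} {l : ℤ} (hm : (k : ℤ) + l = m) {e : ℝ}
    (he : |e| ≤ 17 / 20) :
    |m * log (1 + e) - k * (e - e ^ 2 / 2)| ≤ 7 * (k * |e| ^ 3) + 7 * |e * l| := by
  have hm' : (m : ℝ) = k + l := by exact_mod_cast hm.symm
  have h1 := abs_log_one_add_sub_le he
  have h2 := abs_log_one_add_le he
  have e1 : m * log (1 + e) - k * (e - e ^ 2 / 2) =
      k * (log (1 + e) - (e - e ^ 2 / 2)) + l * log (1 + e) := by rw [hm']; ring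
  rw [e1]
  refine (abs_add_le _ _).trans (add_le_add ?_ ?_)
  · rw [abs_mul, Nat.abs_cast]
    nlinarith [mul_le_mul_of_nonneg_left h1 (Nat.cast_nonneg (α := ℝ) k)]
  · rw [abs_mul, abs_mul]
    nlinarith [mul_le_mul_of_nonneg_left h2 (abs_nonneg (l : ℝ))]

lemma abs_mul_log_one_sub_le {n k m : ℕ} {l : ℤ} (hm : (k : ℤ) + l = m) (hn : 2 ≤ n)
    (hkn : k ≤ n) (hk : k ≠ 0) (hmc : m ≤ k.choose 2) {e : ℝ} (he : |e| ≤ 17 / 20)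
    (hl : |(l : ℝ)| * k ≤ 4 * n) :
    |((k.choose 2 + k * (n - k) - m : ℕ) : ℝ) * log (1 - (1 + e) / n) + k * (1 + e) -
      (1 + e) * (k : ℝ) ^ 2 / (2 * n)| ≤ 60 * ((k : ℝ) / n) + 8 * (1 / k) := by
  have hn2 : (2 : ℝ) ≤ n := by exact_mod_cast hn
  have hn0 : (0 : ℝ) < n := by linarith
  have hk0 : (0 : ℝ) < k := by exact_mod_cast Nat.pos_of_ne_zero hk
  have hm' : (m : ℝ) = k + l := by exact_mod_cast hm.symm
  obtain ⟨he1, he2⟩ := abs_le.1 he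
  have hM := cast_pairs hkn hmc
  set M : ℝ := ((k.choose 2 + k * (n - k) - m : ℕ) : ℝ) with hMdef
  have hM0 : 0 ≤ M := Nat.cast_nonneg _
  have hM1 : M ≤ k * n := by
    rw [hM]
    have : (0 : ℝ) ≤ m := Nat.cast_nonneg m
    have : (0 : ℝ) ≤ (k : ℝ) ^ 2 := by positivity
    linarith
  set p := (1 + e) / n with hp
  have hp0 : 0 ≤ p := div_nonneg (by linarith) hn0.le
  have hp2 : p ≤ 2 / n := by rw [hp]; gcongr; linarith
  have hp1 : p ≤ 37 / 40 := by
    rw [hp, div_le_iff₀ hn0]; linarith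
  have h1 := abs_log_sub_add_sum_range_le (x := p) (by rw [abs_of_nonneg hp0]; linarith) 1
  simp only [Finset.sum_range_one, abs_of_nonneg hp0] at h1
  norm_num at h1
  have h2 : p ^ 2 / (1 - p) ≤ 56 / n ^ 2 := by
    rw [div_le_iff₀ (by linarith)]
    have a : p ^ 2 ≤ (2 / n) ^ 2 := by gcongr
    have b : (2 / (n : ℝ)) ^ 2 = 4 / n ^ 2 := by rw [div_pow]; norm_num
    have c : (0 : ℝ) ≤ 1 / n ^ 2 := by positivity
    have d : (4 : ℝ) / n ^ 2 = 4 * (1 / n ^ 2) := by ring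
    have f : (56 : ℝ) / n ^ 2 = 56 * (1 / n ^ 2) := by ring
    rw [b, d] at a
    rw [f]
    nlinarith
  have h3 : |M * (p + log (1 - p))| ≤ 56 * (k / n) := by
    rw [abs_mul, abs_of_nonneg hM0]
    calc M * |p + log (1 - p)| ≤ (k * n) * (56 / n ^ 2) := by
          gcongr
          exact h1.trans h2
      _ = _ := by field_simp
  have e1 : M * log (1 - p) + k * (1 + e) - (1 + e) * (k : ℝ) ^ 2 / (2 * n) =
      M * (p + log (1 - p)) + ((1 + e) * (3 / 2 * (k / n)) + (1 + e) * (l / n)) := by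
    have : M * p = k * (1 + e) - (1 + e) * (k : ℝ) ^ 2 / (2 * n) -
        ((1 + e) * (3 / 2 * (k / n)) + (1 + e) * (l / n)) := by
      rw [hM, hm', hp]
      field_simp
      ring
    linear_combination -this
  have h4 : |(1 + e) * (l / n)| ≤ 8 * (1 / k) := by
    rw [abs_mul, abs_div, abs_of_pos hn0, abs_of_nonneg (by linarith : 0 ≤ 1 + e)]
    have : |(l : ℝ)| / n ≤ 4 * (1 / k) := by
      rw [mul_one_div, div_le_div_iff₀ hn0 hk0]
      exact hl
    have h0 : 0 ≤ |(l : ℝ)| / n := by positivity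
    nlinarith
  have h5 : |(1 + e) * (3 / 2 * (k / n))| ≤ 4 * ((k : ℝ) / n) := by
    have h0 : 0 ≤ (k : ℝ) / n := by positivity
    rw [abs_of_nonneg (mul_nonneg (by linarith) (by linarith))]
    nlinarith
  rw [e1]
  refine (abs_add_le _ _).trans ?_
  have := abs_add_le ((1 + e) * (3 / 2 * ((k : ℝ) / n))) ((1 + e) * (l / n))
  linarith

lemma abs_exp_sub_one_le (s : ℝ) : |exp s - 1| ≤ |s| * exp |s| := by
  have h1 : 1 ≤ exp |s| := one_le_exp (abs_nonneg s)
  have h2 : exp s ≤ exp |s| := exp_le_exp.2 (le_abs_self s)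
  have h3 := add_one_le_exp s
  have h4 := add_one_le_exp (-s)
  have h5 : exp s * exp (-s) = 1 := by rw [← exp_add]; simp
  have h6 := exp_pos s
  have h7 := abs_nonneg s
  rw [abs_le]
  rcases abs_cases s with ⟨a, b⟩ | ⟨a, b⟩
  · constructor
    · nlinarith
    · rw [a]; nlinarith
  · constructor
    · nlinarith
    · nlinarith

end LogEstimates

/-! ### The asymptotics of the first moment -/

section Asymptotics

open Real Filter Topology
open scoped Nat

lemma relErr_nonneg (k n : ℕ) (l : ℤ) (lam : ℝ) : 0 ≤ relErr k n l lam := by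
  rw [relErr]; positivity

lemma expectedCount_of_neg (n : ℕ) (p : unitInterval) (k : ℕ) {m : ℤ} (hm : m < 0) :
    expectedCount n p k m = 0 := by
  have h : ∀ G : SimpleGraph (Fin n), componentCount G k m = 0 := by
    intro G
    rw [componentCount]
    convert Set.ncard_empty G.ConnectedComponent
    rw [Set.eq_empty_iff_forall_notMem]
    rintro c ⟨-, hc⟩
    omega
  simp [expectedCount, h]

/-- The ratio of the first moment and the main term. -/
noncomputable def momentRatio (n k m : ℕ) (lam : ℝ) : ℝ :=
  (∏ j ∈ Finset.range k, (1 - (j : ℝ) / n)) *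
    ((2 * π) ^ (1 / 2 : ℝ) * (k : ℝ) ^ ((k : ℝ) + 1 / 2) / k !) * (1 + deviation n lam) ^ m *
    (1 - (1 + deviation n lam) / n) ^ (k.choose 2 + k * (n - k) - m) *
    exp (F lam (k / (n : ℝ) ^ (2 / 3 : ℝ)))

lemma expectedCount_eq_mainTerm_mul {n k m : ℕ} {l : ℤ} {lam : ℝ} {p : unitInterval}
    (hp : (p : ℝ) = edgeProb n lam) (hn : n ≠ 0) (hk : k ≠ 0) (hkn : k ≤ n)
    (hm : (k : ℤ) + l = m) :
    expectedCount n p k m = mainTerm k n l lam * momentRatio n k m lam := by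
  have hn0 : (0 : ℝ) < n := by exact_mod_cast Nat.pos_of_ne_zero hn
  have hk0 : (0 : ℝ) < k := by exact_mod_cast Nat.pos_of_ne_zero hk
  have e1 : (n : ℝ) ^ m = (n : ℝ) ^ k * (n : ℝ) ^ l := by
    rw [← zpow_natCast, ← zpow_natCast, ← zpow_add₀ hn0.ne', hm]
  rw [expectedCount_eq, mainTerm, momentRatio, hp, edgeProb_eq hn, cast_choose_eq_prod hn hkn, hm,
    exp_neg, div_pow, e1]
  have h1 : (2 * π : ℝ) ^ (1 / 2 : ℝ) ≠ 0 := (rpow_pos_of_pos (by positivity) _).ne'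
  have h2 : (k : ℝ) ^ ((k : ℝ) + 1 / 2) ≠ 0 := (rpow_pos_of_pos hk0 _).ne'
  have h3 : (n : ℝ) ^ l ≠ 0 := (zpow_pos hn0 _).ne'
  have h4 := (exp_pos (F lam (k / (n : ℝ) ^ (2 / 3 : ℝ)))).ne'
  field_simp

/-- The two-sided estimate of the first moment, on a logarithmic scale. All terms of order larger
than the relative error cancel. -/
lemma abs_log_momentRatio_le {n k m : ℕ} {l : ℤ} {lam : ℝ} (hn : 2 ≤ n) (hk : k ≠ 0)
    (hlam : |lam| ≤ (n : ℝ) ^ (1 / 12 : ℝ)) (hkn : (k : ℝ) / n ≤ 17 / 20)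
    (hm : (k : ℤ) + l = m) (hmc : m ≤ k.choose 2) (hl : |(l : ℝ)| * k ≤ 4 * n) :
    0 < momentRatio n k m lam ∧ |log (momentRatio n k m lam)| ≤ 61 * relErr k n l lam := by
  have hn2 : (2 : ℝ) ≤ n := by exact_mod_cast hn
  have hn0 : (0 : ℝ) < n := by linarith
  have hk0 : (0 : ℝ) < k := by exact_mod_cast Nat.pos_of_ne_zero hk
  have hkn' : k ≤ n := by
    rw [div_le_iff₀ hn0] at hkn
    exact_mod_cast (show (k : ℝ) ≤ n by linarith)
  have he : |deviation n lam| ≤ 17 / 20 :=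
    (abs_deviation_le (by omega) hlam).trans (inv_fourthRoot_le (by omega))
  have hA := abs_log_prod_le (n := n) (k := k) (by omega) hkn
  have hB := abs_stirling_error_le hk
  have hC := abs_mul_log_one_add_le hm he
  have hD := abs_mul_log_one_sub_le hm hn hkn' hk hmc he hl
  have hF := F_eq (n := n) (by omega) k lam
  have hE : relErr k n l lam = (k : ℝ) ^ 4 / (n : ℝ) ^ 3 + |deviation n lam * l| +
      k * |deviation n lam| ^ 3 + (k : ℝ) / n + 1 / (k : ℝ) := by
    have e1 : |lam * l| / (n : ℝ) ^ (1 / 3 : ℝ) = |deviation n lam * l| := by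
      rw [deviation_eq_div, div_mul_eq_mul_div, abs_div,
        abs_of_pos (rpow_pos_of_pos hn0 (1 / 3 : ℝ))]
    have e2 : k * |lam| ^ 3 / n = k * |deviation n lam| ^ 3 := by
      rw [← abs_pow, ← abs_pow, deviation_pow_three, abs_div, abs_of_pos hn0, mul_div_assoc]
    rw [relErr, e1, e2]
  obtain ⟨he1, he2⟩ := abs_le.1 he
  rw [momentRatio, hE]
  set e := deviation n lam with hedef
  have hP : 0 < ∏ j ∈ Finset.range k, (1 - (j : ℝ) / n) := by
    refine Finset.prod_pos fun j hj => ?_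
    have : (j : ℝ) / n ≤ k / n := by
      have := (Finset.mem_range.1 hj).le
      gcongr
    linarith
  have hS : 0 < (2 * π) ^ (1 / 2 : ℝ) * (k : ℝ) ^ ((k : ℝ) + 1 / 2) / k ! := by
    have h1 : 0 < (2 * π : ℝ) ^ (1 / 2 : ℝ) := rpow_pos_of_pos (by positivity) _
    have h2 : 0 < (k : ℝ) ^ ((k : ℝ) + 1 / 2) := rpow_pos_of_pos hk0 _
    positivity
  have h1e : 0 < 1 + e := by linarith
  have hq : 0 < 1 - (1 + e) / n := by
    rw [sub_pos, div_lt_one hn0]; linarith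
  have hlogS : log ((2 * π) ^ (1 / 2 : ℝ) * (k : ℝ) ^ ((k : ℝ) + 1 / 2) / k !) =
      log (2 * π) / 2 + (k + 1 / 2) * log k - log k ! := by
    rw [log_div (by positivity) (by positivity), log_mul (rpow_pos_of_pos (by positivity) _).ne'
      (rpow_pos_of_pos hk0 _).ne', log_rpow (by positivity), log_rpow hk0]
    ring
  refine ⟨by positivity, ?_⟩
  rw [log_mul (by positivity) (exp_pos _).ne', log_mul (by positivity) (by positivity),
    log_mul (by positivity) (by positivity), log_mul hP.ne' hS.ne', log_exp, log_pow, log_pow,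
    hlogS, hF]
  set a := log (∏ j ∈ Finset.range k, (1 - (j : ℝ) / n))
  set b := log (2 * π) / 2 + (k + 1 / 2) * log k - log k !
  set c := m * log (1 + e)
  set d := ((k.choose 2 + k * (n - k) - m : ℕ) : ℝ) * log (1 - (1 + e) / n)
  have key : a + b + c + d + ((k : ℝ) ^ 3 / (6 * (n : ℝ) ^ 2) - e * (k : ℝ) ^ 2 / (2 * n) +
      e ^ 2 * k / 2) = (a + (k : ℝ) ^ 2 / (2 * n) + (k : ℝ) ^ 3 / (6 * (n : ℝ) ^ 2)) + (b - k) +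
      (c - k * (e - e ^ 2 / 2)) + (d + k * (1 + e) - (1 + e) * (k : ℝ) ^ 2 / (2 * n)) := by
    ring
  rw [key]
  have t1 : (0 : ℝ) ≤ (k : ℝ) ^ 4 / (n : ℝ) ^ 3 := by positivity
  have t2 : 0 ≤ |e * l| := abs_nonneg _
  have t3 : 0 ≤ k * |e| ^ 3 := by positivity
  have t5 : (0 : ℝ) ≤ 1 / k := by positivity
  refine (abs_add_le _ _).trans ?_
  have u1 := abs_add_le ((a + (k : ℝ) ^ 2 / (2 * n) + (k : ℝ) ^ 3 / (6 * (n : ℝ) ^ 2)) + (b - k))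
    (c - k * (e - e ^ 2 / 2))
  have u2 := abs_add_le (a + (k : ℝ) ^ 2 / (2 * n) + (k : ℝ) ^ 3 / (6 * (n : ℝ) ^ 2)) (b - k)
  linarith

lemma relErr_le {n k : ℕ} {l : ℤ} {lam : ℝ} (hn : n ≠ 0)
    (hlam : |lam| ≤ (n : ℝ) ^ (1 / 12 : ℝ)) (hk : 1 ≤ k)
    (hkn : (k : ℝ) ≤ (n : ℝ) ^ (3 / 4 : ℝ)) (hl : |(l : ℝ)| ≤ 4 * (n : ℝ) ^ (1 / 4 : ℝ)) :
    relErr k n l lam ≤ 8 := by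
  have hn0 : (0 : ℝ) < n := by exact_mod_cast Nat.pos_of_ne_zero hn
  have hk0 : (1 : ℝ) ≤ k := by exact_mod_cast hk
  have hg := fourthRoot_pow n
  have hg1 := one_le_fourthRoot hn
  have h34 : (n : ℝ) ^ (3 / 4 : ℝ) = ((n : ℝ) ^ (1 / 4 : ℝ)) ^ 3 := by
    rw [← rpow_natCast, ← rpow_mul hn0.le]; norm_num
  have h112 : (n : ℝ) ^ (1 / 4 : ℝ) = ((n : ℝ) ^ (1 / 12 : ℝ)) ^ 3 := by
    rw [← rpow_natCast, ← rpow_mul hn0.le]; norm_num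
  have hdev := abs_deviation_le hn hlam
  rw [h34] at hkn
  have hlam3 : |lam| ^ 3 ≤ (n : ℝ) ^ (1 / 4 : ℝ) := by rw [h112]; gcongr
  have e1 : |lam * l| / (n : ℝ) ^ (1 / 3 : ℝ) = |deviation n lam| * |(l : ℝ)| := by
    rw [← abs_mul, deviation_eq_div, div_mul_eq_mul_div, abs_div,
      abs_of_pos (rpow_pos_of_pos hn0 (1 / 3 : ℝ))]
  rw [relErr, e1]
  set g := (n : ℝ) ^ (1 / 4 : ℝ)
  have hg0 : 0 < g := by linarith
  have a1 : (k : ℝ) ^ 4 / (n : ℝ) ^ 3 ≤ 1 := by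
    rw [div_le_one (by positivity), ← hg]
    calc (k : ℝ) ^ 4 ≤ (g ^ 3) ^ 4 := by gcongr
      _ = _ := by ring
  have a2 : |deviation n lam| * |(l : ℝ)| ≤ 4 := by
    calc _ ≤ (1 / g) * (4 * g) := by gcongr
      _ = 4 := by field_simp
  have a3 : k * |lam| ^ 3 / n ≤ 1 := by
    rw [div_le_one hn0, ← hg]
    calc k * |lam| ^ 3 ≤ g ^ 3 * g := by gcongr
      _ = _ := by ring
  have a4 : (k : ℝ) / n ≤ 1 := by
    rw [div_le_one hn0, ← hg]
    calc (k : ℝ) ≤ g ^ 3 := hkn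
      _ ≤ g ^ 4 := pow_le_pow_right₀ hg1 (by norm_num)
  have a5 : 1 / (k : ℝ) ≤ 1 := by rw [div_le_one (by linarith)]; exact hk0
  linarith

/-- The first moment of the number of components in the near-critical window. The constant comes
from `|R - 1| ≤ |log R| * exp |log R|` for the ratio `R`, with `|log R| ≤ 61 * relErr ≤ 61 * 8`. -/
lemma exists_expectedCount_eq {n k : ℕ} {l : ℤ} {lam : ℝ} {p : unitInterval}
    (hp : (p : ℝ) = edgeProb n lam) (hlam : |lam| ≤ (n : ℝ) ^ (1 / 12 : ℝ)) (hk : 1 ≤ k)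
    (hkn : (k : ℝ) ≤ (n : ℝ) ^ (3 / 4 : ℝ)) (hl : (l : ℝ) ≤ 4 * (n : ℝ) ^ (1 / 4 : ℝ)) :
    ∃ δ : ℝ, |δ| ≤ (61 * exp 488) * relErr k n l lam ∧
      expectedCount n p k (k + l) = mainTerm k n l lam * (1 + δ) := by
  have herr := relErr_nonneg k n l lam
  have hk0 : (1 : ℝ) ≤ k := by exact_mod_cast hk
  -- without connected graphs of this kind, both sides vanish
  have hzero : expectedCount n p k (k + l) = 0 → connectedCount k (k + l) = 0 →
      ∃ δ : ℝ, |δ| ≤ (61 * exp 488) * relErr k n l lam ∧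
      expectedCount n p k (k + l) = mainTerm k n l lam * (1 + δ) := by
    intro h1 h2
    refine ⟨0, by rw [abs_zero]; positivity, ?_⟩
    rw [h1, mainTerm, h2]
    simp
  rcases lt_or_ge ((k : ℤ) + l) 0 with hneg | hpos
  · exact hzero (expectedCount_of_neg n p k hneg) (connectedCount_eq_zero (by omega))
  obtain ⟨m, hm⟩ : ∃ m : ℕ, (k : ℤ) + l = m := ⟨(k + l).toNat, by omega⟩
  by_cases hC : connectedCount k m = 0
  · rw [← hm] at hC
    refine hzero ?_ hC
    rw [hm, expectedCount_eq, ← hm, hC]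
    simp
  have hmc := le_choose_two_of_connectedCount_ne_zero hC
  have hl1 : -1 ≤ l := by
    by_contra hlt
    exact hC (connectedCount_eq_zero (by omega))
  have hn : n ≠ 0 := by
    rintro rfl
    rw [Nat.cast_zero, zero_rpow (by norm_num)] at hkn
    linarith
  have hn0 : (0 : ℝ) < n := by exact_mod_cast Nat.pos_of_ne_zero hn
  have hg := fourthRoot_pow n
  have hg1 := one_le_fourthRoot hn
  have h34 : (n : ℝ) ^ (3 / 4 : ℝ) = ((n : ℝ) ^ (1 / 4 : ℝ)) ^ 3 := by
    rw [← rpow_natCast, ← rpow_mul hn0.le]; norm_num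
  have hlabs : |(l : ℝ)| ≤ 4 * (n : ℝ) ^ (1 / 4 : ℝ) := by
    rw [abs_le]
    have : (-1 : ℝ) ≤ l := by exact_mod_cast hl1
    exact ⟨by linarith, hl⟩
  have herr8 := relErr_le hn hlam hk hkn hlabs
  have hkn' : k ≤ n := by
    have : (k : ℝ) ≤ n := by
      rw [h34] at hkn
      rw [← hg]
      exact hkn.trans (pow_le_pow_right₀ hg1 (by norm_num))
    exact_mod_cast this
  suffices h : 0 < momentRatio n k m lam ∧
      |log (momentRatio n k m lam)| ≤ 61 * relErr k n l lam by
    refine ⟨momentRatio n k m lam - 1, ?_, ?_⟩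
    · have h1 := abs_exp_sub_one_le (log (momentRatio n k m lam))
      rw [exp_log h.1] at h1
      refine h1.trans ?_
      have h2 : exp |log (momentRatio n k m lam)| ≤ exp 488 := exp_le_exp.2 (by linarith [h.2])
      calc _ ≤ (61 * relErr k n l lam) * exp 488 :=
            mul_le_mul h.2 h2 (exp_pos _).le (by positivity)
        _ = _ := by ring
    · rw [hm, expectedCount_eq_mainTerm_mul hp hn (by omega) hkn' hm]
      ring
  rcases Nat.lt_or_ge n 2 with hn2 | hn2
  -- for `n = 1` the edge probability need not be small, but the relative error is at least `1`
  · obtain rfl : n = 1 := by omega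
    obtain rfl : k = 1 := by omega
    obtain rfl : m = 0 := by simpa using hmc
    have hF : |F lam 1| ≤ 2 := by
      rw [Nat.cast_one, one_rpow] at hlam
      obtain ⟨a, b⟩ := abs_le.1 hlam
      rw [F, abs_le]
      constructor <;> nlinarith
    have hR : momentRatio 1 1 0 lam = (2 * π) ^ (1 / 2 : ℝ) * exp (F lam 1) := by
      simp [momentRatio]
    have h2pi : 0 < (2 * π : ℝ) ^ (1 / 2 : ℝ) := rpow_pos_of_pos (by positivity) _
    have hlog2pi : |log (2 * π)| ≤ 8 := by
      have := log_le_sub_one_of_pos (show 0 < 2 * π by positivity)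
      have h1 : 0 ≤ log (2 * π) := log_nonneg (by linarith [pi_gt_three])
      rw [abs_of_nonneg h1]
      linarith [pi_lt_four]
    have herr1 : 1 ≤ relErr 1 1 l lam := by
      rw [relErr]
      have : (0 : ℝ) ≤ ((1 : ℕ) : ℝ) ^ 4 / ((1 : ℕ) : ℝ) ^ 3 +
        |lam * l| / ((1 : ℕ) : ℝ) ^ (1 / 3 : ℝ) + ((1 : ℕ) : ℝ) * |lam| ^ 3 / ((1 : ℕ) : ℝ) +
        ((1 : ℕ) : ℝ) / ((1 : ℕ) : ℝ) := by positivity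
      have h1 : 1 / ((1 : ℕ) : ℝ) = 1 := by simp
      rw [h1]
      linarith
    rw [hR]
    refine ⟨by positivity, ?_⟩
    rw [log_mul h2pi.ne' (exp_pos _).ne', log_exp, log_rpow (by positivity)]
    obtain ⟨a, b⟩ := abs_le.1 hF
    obtain ⟨c, d⟩ := abs_le.1 hlog2pi
    rw [abs_le]
    constructor <;> linarith
  · refine abs_log_momentRatio_le hn2 (by omega) hlam ?_ hm hmc ?_
    · refine le_trans ?_ (inv_fourthRoot_le hn2)
      rw [h34] at hkn
      rw [div_le_div_iff₀ hn0 (by positivity), one_mul]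
      calc (k : ℝ) * (n : ℝ) ^ (1 / 4 : ℝ)
          ≤ ((n : ℝ) ^ (1 / 4 : ℝ)) ^ 3 * (n : ℝ) ^ (1 / 4 : ℝ) := by gcongr
        _ = ((n : ℝ) ^ (1 / 4 : ℝ)) ^ 4 := by ring
        _ = n := hg
    · rw [h34] at hkn
      calc |(l : ℝ)| * k ≤ (4 * (n : ℝ) ^ (1 / 4 : ℝ)) * ((n : ℝ) ^ (1 / 4 : ℝ)) ^ 3 := by gcongr
        _ = 4 * ((n : ℝ) ^ (1 / 4 : ℝ)) ^ 4 := by ring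
        _ = 4 * n := by rw [hg]

end Asymptotics

end NearCriticalGraph

theorem proposition2p2 :
    (∃ K : ℝ, ∀ (n k : ℕ) (l : ℤ) (lam : ℝ) (p : unitInterval),
      (p : ℝ) = NearCriticalGraph.edgeProb n lam →
      |lam| ≤ (n : ℝ) ^ (1 / 12 : ℝ) →
      1 ≤ k → (k : ℝ) ≤ (n : ℝ) ^ (3 / 4 : ℝ) →
      (l : ℝ) ≤ 4 * (n : ℝ) ^ (1 / 4 : ℝ) →
      ∃ δ : ℝ, |δ| ≤ K * NearCriticalGraph.relErr k n l lam ∧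
        NearCriticalGraph.expectedCount n p k (k + l) =
          NearCriticalGraph.mainTerm k n l lam * (1 + δ)) ∧
    (∃ c : ℝ, ∀ (n k : ℕ) (l : ℤ) (lam : ℝ) (p : unitInterval),
      (p : ℝ) = NearCriticalGraph.edgeProb n lam →
      |lam| ≤ (n : ℝ) ^ (1 / 12 : ℝ) →
      3 ≤ n → 1 ≤ k → k + 1 ≤ n → -1 ≤ l →
      NearCriticalGraph.expectedCount n p k (k + l) ≤
        c * NearCriticalGraph.upperTerm k n l lam) :=
  ⟨⟨61 * Real.exp 488, fun _ _ _ _ _ hp hlam hk hkn hl =>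
      NearCriticalGraph.exists_expectedCount_eq hp hlam hk hkn hl⟩,
    ⟨48 * 84 ^ 3 * Real.exp 4, fun _ _ _ _ _ hp hlam hn hk hkn hl =>
      NearCriticalGraph.expectedCount_le hp hlam hn hk hkn hl⟩⟩
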